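/- **Theorem 4.4.** Let $(X,Y)$ be a dual pair of real locally convex spaces: $\langle\cdot,\cdot\rangle$ is a bilinear form on $X\times Y$ separating the points of $X$ and of $Y$, and the topologies of $X$ and $Y$ are locally convex vector topologies compatible with it (the continuous linear functionals on $X$ are exactly the maps $\langle\cdot,x^*\rangle$, $x^*\in Y$, and those on $Y$ are exactly the maps $\langle x,\cdot\rangle$, $x\in X$). Let $\Phi:X\to\mathbb R\cup\{+\infty\}$ have nonempty domain $\operatorname{dom}\Phi=\{\Phi<+\infty\}$ and a convex and closed epigraph. Write $\Phi^*(x^*)=\sup_{x\in X}(\langle x,x^*\rangle-\Phi(x))$ for its conjugate and $\partial\Phi(x)$ for its subdifferential, that is, $\partial\Phi(x)=\{x^*\in Y:\langle u-x,x^*\rangle\le\Phi(u)-\Phi(x)\ \ \forall u\in X\}$ if $x\in\operatorname{dom}\Phi$ and $\partial\Phi(x)=\emptyset$ otherwise. For a set $S$, let $\operatorname{ri}S$ be the interior of $S$ relative to its affine hull $\operatorname{aff}S$ if $\operatorname{aff}S$ is closed, and $\operatorname{ri}S=\emptyset$ otherwise. Assume that at least one of the following holds: * $\operatorname{ri}(\operatorname{dom}\Phi)\neq\emptyset$,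 and the restriction of $\Phi$ to $\operatorname{aff}(\operatorname{dom}\Phi)$ is finite and continuous at every point of $\operatorname{ri}(\operatorname{dom}\Phi)$; * with respect to the Mackey topology $\tau(Y,X)$ on $Y$ (uniform convergence on the absolutely convex $\sigma(X,Y)$-compact subsets of $X$), $\operatorname{ri}(\operatorname{dom}\Phi^*)\neq\emptyset$, and the restriction of $\Phi^*$ to $\operatorname{aff}(\operatorname{dom}\Phi^*)$ is finite and continuous at every point of $\operatorname{ri}(\operatorname{dom}\Phi^*)$. Then for every $\bar x\in\operatorname{dom}\Phi$, the normal cone $\mathrm N_{[\Phi\le\Phi(\bar x)]}(\bar x)=\{x^*\in Y:\langle x-\bar x,x^*\rangle\le0 \text{ for all } x \text{ with } \Phi(x)\le\Phi(\bar x)\}$ satisfies $$\mathrm N_{[\Phi\le\Phi(\bar x)]}(\bar x)=\limsup_{\substack{x\to_{\operatorname{dom}\Phi^*}\bar x,\ \mu\ge0\\ \mu(\Phi(x)-\Phi(\bar x))\to0\\ \mu\langle\cdot,x-\bar x\rangle\to0}}\mu\,\partial\Phi(x)=\limsup_{\substack{\mu\ge0\\ \mu(\Phi(x)-\Phi(\bar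 x))\to0\\ \mu\langle\cdot,x-\bar x\rangle\to0}}\mu\,\partial\Phi(x).$$ Here the last upper limit is the set of all limits in $Y$ of convergent nets $(\mu_ix_i^*)_i$ with $\mu_i\ge0$, $x_i\in X$, $x_i^*\in\partial\Phi(x_i)$, $\mu_i(\Phi(x_i)-\Phi(\bar x))\to0$ and $\mu_i\langle x_i-\bar x,x_i^*\rangle\to0$; in the first upper limit one requires in addition that $x_i\to_{\operatorname{dom}\Phi^*}\bar x$, which means that the class of $x_i$ converges to the class of $\bar x$ in the topological quotient space $X/(\operatorname{dom}\Phi^*)^\perp$, where $(\operatorname{dom}\Phi^*)^\perp=\{x\in X:\langle x,x^*\rangle=0\ \ \forall x^*\in\operatorname{dom}\Phi^*\}$. -/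

import Mathlib

open Filter Topology

noncomputable section

namespace ConvexDual

/-- `(X, Y)` is a dual pair of locally convex spaces for the bilinear form `B`: `B` separates the
points of `X` and of `Y`, and the given topologies of `X` and `Y` are compatible with the pairing,
i.e. the continuous linear functionals on `X` are exactly the maps `B · y`, and those on `Y` are
exactly the maps `B x ·`. -/
structure IsDualPair {X Y : Type*} [AddCommGroup X] [Module ℝ X] [TopologicalSpace X]
    [AddCommGroup Y] [Module ℝ Y] [TopologicalSpace Y] (B : X →ₗ[ℝ] Y →ₗ[ℝ] ℝ) : Prop where
  separatingLeft : B.SeparatingLeft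
  separatingRight : B.SeparatingRight
  continuous_left_iff : ∀ f : X →ₗ[ℝ] ℝ, Continuous f ↔ ∃ y : Y, f = B.flip y
  continuous_right_iff : ∀ g : Y →ₗ[ℝ] ℝ, Continuous g ↔ ∃ x : X, g = B x

section Functions

variable {E : Type*}

/-- Effective domain of an extended real valued function. -/
def dom (f : E → EReal) : Set E := {x | f x < ⊤}

/-- Epigraph, as a subset of `E × ℝ`. -/
def epi (f : E → EReal) : Set (E × ℝ) := {p | f p.1 ≤ (p.2 : EReal)}

/-- `f ∈ Γ₀(E)`: `f` takes values in `ℝ ∪ {+∞}`, has nonempty domain, and its epigraph is convex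
and closed. -/
structure IsGammaZero [AddCommGroup E] [Module ℝ E] [TopologicalSpace E] (f : E → EReal) :
    Prop where
  ne_bot : ∀ x, f x ≠ ⊥
  dom_nonempty : (dom f).Nonempty
  convex_epi : Convex ℝ (epi f)
  isClosed_epi : IsClosed (epi f)

/-- Sublevel set `[f ≤ c]`. -/
def sublevel (f : E → EReal) (c : EReal) : Set E := {x | f x ≤ c}

open Classical in
/-- Relative interior of `S` for the topology `t`: the interior of `S` relative to its affine hull
if this hull is closed, and the empty set otherwise. -/
def relInterior [AddCommGroup E] [Module ℝ E] (t : TopologicalSpace E) (S : Set E) : Set E :=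
  if IsClosed[t] (affineSpan ℝ S : Set E) then intrinsicInterior ℝ S else ∅

/-- With respect to the topology `t`, `ri (dom f)` is nonempty and the restriction of `f` to the
affine hull of `dom f` is finite and continuous at every point of `ri (dom f)`. -/
def FiniteContinuousOnRelInterior [AddCommGroup E] [Module ℝ E] (t : TopologicalSpace E)
    (f : E → EReal) : Prop :=
  (relInterior t (dom f)).Nonempty ∧
    ∀ x ∈ relInterior t (dom f), f x ≠ ⊥ ∧ f x ≠ ⊤ ∧
      ContinuousWithinAt f (affineSpan ℝ (dom f) : Set E) x

/-- Painlevé–Kuratowski upper limit of the multifunction `M` along the filter `F` of the source: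
every neighbourhood of `v` meets `M u` for some `u` in each member of `F`. -/
def upperLimit {U V : Type*} [TopologicalSpace V] (F : Filter U) (M : U → Set V) : Set V :=
  {v | ∀ W ∈ 𝓝 v, ∀ Z ∈ F, ∃ u ∈ Z, (M u ∩ W).Nonempty}

end Functions

section Pairing

variable {X Y : Type*} [AddCommGroup X] [Module ℝ X] [AddCommGroup Y] [Module ℝ Y]

/-- The weak topology `σ(X, Y)`. -/
abbrev weakTopology (B : X →ₗ[ℝ] Y →ₗ[ℝ] ℝ) : TopologicalSpace X :=
  TopologicalSpace.induced (fun x : X => fun y : Y => B x y) inferInstance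

/-- The Mackey topology `τ(Y, X)` on `Y`: uniform convergence on the absolutely convex
`σ(X, Y)`-compact subsets of `X`. -/
abbrev mackeyTopology (B : X →ₗ[ℝ] Y →ₗ[ℝ] ℝ) : TopologicalSpace Y :=
  TopologicalSpace.induced
    (fun y : Y => UniformOnFun.ofFun
      {K : Set X | Convex ℝ K ∧ Balanced ℝ K ∧ @IsCompact X (weakTopology B) K}
      (fun x : X => B x y))
    inferInstance

/-- Fenchel conjugate. -/
def conj (B : X →ₗ[ℝ] Y →ₗ[ℝ] ℝ) (f : X → EReal) (y : Y) : EReal :=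
  ⨆ x : X, (((B x y : ℝ) : EReal) - f x)

/-- Normal cone to `S` at `x₀`. -/
def normalCone (B : X →ₗ[ℝ] Y →ₗ[ℝ] ℝ) (S : Set X) (x₀ : X) : Set Y :=
  {y | ∀ x ∈ S, B (x - x₀) y ≤ 0}

/-- Subdifferential of `f` at `x`; it is empty when `x` is outside `dom f`. -/
def subdiff (B : X →ₗ[ℝ] Y →ₗ[ℝ] ℝ) (f : X → EReal) (x : X) : Set Y :=
  {y | x ∈ dom f ∧ ∀ u : X, ((B (u - x) y : ℝ) : EReal) ≤ f u - f x}

/-- The orthogonal space `A^⊥ ⊆ X` of a set `A ⊆ Y`. -/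
def orth (B : X →ₗ[ℝ] Y →ₗ[ℝ] ℝ) (A : Set Y) : Submodule ℝ X where
  carrier := {x | ∀ y ∈ A, B x y = 0}
  add_mem' := by
    intro a b ha hb y hy
    simp [ha y hy, hb y hy]
  zero_mem' := by
    intro y _
    simp
  smul_mem' := by
    intro c x hx y hy
    simp [hx y hy]

/-- The multifunction `μ ∂f(x)`, indexed by triples `(x, μ, x*)`: its value is `{μ x*}` if
`x* ∈ ∂f(x)`, and empty otherwise. -/
def scaledSubdiff (B : X →ₗ[ℝ] Y →ₗ[ℝ] ℝ) (f : X → EReal) (p : X × ℝ × Y) : Set Y :=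
  {y | p.2.2 ∈ subdiff B f p.1 ∧ y = p.2.1 • p.2.2}

/-- The filter on triples `(x, μ, x*)` expressing `μ ≥ 0`, `μ (f x - f x₀) → 0` and
`μ ⟨x*, x - x₀⟩ → 0`. It is used only at triples with `x* ∈ ∂f(x)`, where `f x` is a real number. -/
def valueFilter (B : X →ₗ[ℝ] Y →ₗ[ℝ] ℝ) (f : X → EReal) (x₀ : X) : Filter (X × ℝ × Y) :=
  𝓟 {p | 0 ≤ p.2.1} ⊓
    comap (fun p => p.2.1 * ((f p.1).toReal - (f x₀).toReal)) (𝓝 0) ⊓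
    comap (fun p => p.2.1 * B (p.1 - x₀) p.2.2) (𝓝 0)

/-- The filter on triples `(x, μ, x*)` expressing `x →_A x₀`: the class of `x` converges to the
class of `x₀` in the topological quotient `X / A^⊥`. -/
def quotientFilter [TopologicalSpace X] (B : X →ₗ[ℝ] Y →ₗ[ℝ] ℝ) (A : Set Y) (x₀ : X) :
    Filter (X × ℝ × Y) :=
  comap (fun p => (Submodule.Quotient.mk p.1 : X ⧸ orth B A))
    (𝓝 (Submodule.Quotient.mk x₀ : X ⧸ orth B A))

end Pairing

end ConvexDual

end

open ConvexDual

/-!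
Let `v` be normal to `[Φ ≤ Φ x₀]` at `x₀`. By biconjugation and separation, `(v, 0)` lies in the
closure of the cone generated by the pairs `(y, ε)` with `y` an `ε`-subgradient of `Φ` at `x₀`, so
`v` is a limit of `μ y` with `μ ε → 0`. A Brøndsted–Rockafellar argument turns these `y` into exact
subgradients at points near `x₀`. It does not need a complete metric: the penalty is the gauge of a
weakly compact disc, so minima exist by compactness, while the continuity of `Φ` on the affine hull
of its domain makes the sum rule available. If `Φ*` rather than `Φ` is relatively continuous, the
same argument runs in `Y` with its Mackey topology, whose dual is again `X`. Choosing the discs as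
polars of neighbourhoods of zero keeps both the displacement of the point and that of the
subgradient small, so the points converge to `x₀` even in the topology of `X`.
-/

noncomputable section

namespace ConvexDual

open scoped Pointwise

section TopologicalVectorSpace

theorem eventually_smul_subset {E ι : Type*} [AddCommGroup E] [Module ℝ E] [TopologicalSpace E]
    {K U : Set E} (hK : Bornology.IsVonNBounded ℝ K) (hU : U ∈ 𝓝 0) {l : Filter ι} {c : ι → ℝ}
    (hc : Tendsto c l (𝓝 0)) : ∀ᶠ i in l, c i • K ⊆ U :=
  hc.eventually (((hK hU).eventually_nhds_zero (mem_of_mem_nhds hU)).mono fun _ h =>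
    Set.image_subset_iff.2 h)

variable {E : Type*} [AddCommGroup E] [Module ℝ E] [TopologicalSpace E]
  [IsTopologicalAddGroup E] [ContinuousSMul ℝ E]

theorem continuous_of_abs_le_one_of_mem_nhds (g : E →ₗ[ℝ] ℝ) {W : Set E} (hW : W ∈ 𝓝 0)
    (h : ∀ w ∈ W, |g w| ≤ 1) : Continuous g := by
  have hbdd : Bornology.IsVonNBounded ℝ (g '' W) := by
    refine (NormedSpace.isVonNBounded_closedBall ℝ ℝ 1).subset ?_
    rintro _ ⟨w, hw, rfl⟩
    simpa using h w hw
  exact (g.clmOfExistsBoundedImage ⟨W, hW, hbdd⟩).continuous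

theorem exists_absConvex_isClosed_nhds_add_subset [LocallyConvexSpace ℝ E] {W : Set E}
    (hW : W ∈ 𝓝 0) : ∃ V ∈ 𝓝 (0 : E), AbsConvex ℝ V ∧ IsClosed V ∧ V + V ⊆ W := by
  obtain ⟨U, hU, hUc, -, hUW⟩ := exists_closed_nhds_zero_neg_eq_add_subset hW
  obtain ⟨V, ⟨hV, hVa⟩, hVU⟩ := (nhds_hasBasis_absConvex ℝ E).mem_iff.1 hU
  have hcl : closure V ⊆ U := closure_minimal hVU hUc
  exact ⟨closure V, mem_of_superset hV subset_closure, hVa.closure, isClosed_closure,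
    (Set.add_subset_add hcl hcl).trans hUW⟩

theorem exists_inter_subset_smul_of_isCompact {K V : Set E} (hK : IsCompact K) (hK0 : K.Nonempty)
    (hV : IsClosed V) (hVa : Absorbent ℝ V) :
    ∃ k ∈ K, ∃ O ∈ 𝓝 k, ∃ n : ℕ, K ∩ O ⊆ (n + 1 : ℝ) • V := by
  have : CompactSpace K := isCompact_iff_compactSpace.1 hK
  have : Nonempty K := hK0.to_subtype
  have hcl (n : ℕ) : IsClosed (Subtype.val ⁻¹' ((n + 1 : ℝ) • V) : Set K) :=
    (hV.smul_of_ne_zero n.cast_add_one_ne_zero).preimage continuous_subtype_val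
  have hcover : ⋃ n : ℕ, (Subtype.val ⁻¹' ((n + 1 : ℝ) • V) : Set K) = Set.univ := by
    refine Set.eq_univ_of_forall fun k => Set.mem_iUnion.2 ?_
    obtain ⟨r, -, hr⟩ := (hVa k).exists_pos
    obtain ⟨n, hn⟩ := exists_nat_ge r
    refine ⟨n, hr _ ?_ rfl⟩
    rw [Real.norm_of_nonneg (by positivity)]
    linarith
  obtain ⟨n, k, hk⟩ := nonempty_interior_of_iUnion_of_closed hcl hcover
  obtain ⟨O, hO, hOV⟩ := mem_nhds_subtype K k _ |>.1 (mem_interior_iff_mem_nhds.1 hk)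
  exact ⟨k, k.2, O, hO, n, fun x hx => hOV (a := ⟨x, hx.1⟩) hx.2⟩

theorem absorbs_of_isCompact {K V : Set E} (hKc : IsCompact K) (hK : AbsConvex ℝ K)
    (hVc : IsClosed V) (hV : AbsConvex ℝ V) (hVa : Absorbent ℝ V) : Absorbs ℝ V K := by
  rcases K.eq_empty_or_nonempty with rfl | hK0
  · exact Absorbs.empty
  obtain ⟨k₀, hk₀, O, hO, n, hn⟩ :=
    exists_inter_subset_smul_of_isCompact hKc hK0 hVc hVa
  have hO' : (k₀ + ·) ⁻¹' O ∈ 𝓝 (0 : E) :=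
    (continuous_const_add k₀).continuousAt.preimage_mem_nhds (by simpa using hO)
  have hKk₀ : Absorbs ℝ ((k₀ + ·) ⁻¹' O) ((· - k₀) '' K) :=
    (hKc.image (continuous_sub_right k₀)).isVonNBounded ℝ hO'
  obtain ⟨s, hs, hs1, hs0⟩ := ((hKk₀.eventually_nhds_zero (mem_of_mem_nhds hO')).filter_mono
    nhdsWithin_le_nhds |>.and (Ioo_mem_nhdsGT one_pos)).exists
  have hmem : ∀ k ∈ K, k₀ + s • (k - k₀) ∈ (n + 1 : ℝ) • V := fun k hk =>
    hn ⟨hK.2.add_smul_sub_mem hk₀ hk ⟨hs1.le, hs0.le⟩, hs (Set.mem_image_of_mem _ hk)⟩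
  refine Absorbs.of_norm ⟨s⁻¹ * (n + 1), fun c hc k hk => ?_⟩
  have hsub : s • k ∈ (n + 1 : ℝ) • V := by
    have h := (hV.2.smul _).midpoint_mem (hmem k hk)
      ((hV.1.smul _).neg_mem_iff.2 (hmem (-k) (hK.1.neg_mem_iff.2 hk)))
    convert h using 1
    rw [midpoint_eq_smul_add, invOf_eq_inv]
    module
  refine hV.1.smul_mono (a := s⁻¹ * (n + 1)) ?_ ?_
  · rwa [Real.norm_of_nonneg (by positivity)]
  · rw [mul_smul, Set.mem_smul_set_iff_inv_smul_mem₀ (by positivity), inv_inv]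
    exact hsub

end TopologicalVectorSpace

section Duality

variable {X Y : Type*} [AddCommGroup X] [Module ℝ X] [AddCommGroup Y] [Module ℝ Y]
  {B : X →ₗ[ℝ] Y →ₗ[ℝ] ℝ}

theorem weak_isTopologicalAddGroup : @IsTopologicalAddGroup X (weakTopology B) _ :=
  inferInstanceAs (IsTopologicalAddGroup (WeakBilin B))

theorem weak_continuousSMul : @ContinuousSMul ℝ X _ _ (weakTopology B) :=
  inferInstanceAs (ContinuousSMul ℝ (WeakBilin B))

theorem weak_locallyConvexSpace : @LocallyConvexSpace ℝ X _ _ _ _ (weakTopology B) :=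
  inferInstanceAs (LocallyConvexSpace ℝ (WeakBilin B))

theorem weak_t2Space (hB : Function.Injective B) : @T2Space X (weakTopology B) :=
  (WeakBilin.isEmbedding hB).t2Space

theorem weak_continuous_apply (y : Y) : Continuous[weakTopology B, _] (fun x => B x y) :=
  WeakBilin.eval_continuous B y

theorem exists_inv_smul_mem_polar {K : Set X} (hK : Balanced ℝ K) (hK0 : K.Nonempty) {y : Y}
    {u : ℝ} (h : ∀ x ∈ K, B x y < u) : 0 < u ∧ u⁻¹ • y ∈ B.polar K := by
  have hu : 0 < u := by simpa using h 0 (hK.zero_mem hK0)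
  refine ⟨hu, fun x hx => ?_⟩
  have hneg := h (-x) (hK.neg_mem_iff.2 hx)
  rw [map_neg, LinearMap.neg_apply] at hneg
  rw [map_smul, smul_eq_mul, Real.norm_eq_abs, abs_mul, abs_of_pos (inv_pos.2 hu),
    inv_mul_le_one₀ hu, abs_le]
  exact ⟨by linarith, (h x hx).le⟩

theorem bipolar_eq [TopologicalSpace X] [IsTopologicalAddGroup X] [ContinuousSMul ℝ X]
    [LocallyConvexSpace ℝ X] (hB : ∀ f : StrongDual ℝ X, ∃ y, ∀ x, f x = B x y) {V : Set X}
    (hV : AbsConvex ℝ V) (hVc : IsClosed V) (hV0 : V.Nonempty) :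
    B.flip.polar (B.polar V) = V := by
  refine (B.subset_bipolar V).antisymm' fun x hx => ?_
  by_contra hxV
  obtain ⟨f, u, hfu, hux⟩ := geometric_hahn_banach_closed_point hV.2 hVc hxV
  obtain ⟨y, hy⟩ := hB f
  simp only [hy] at hfu hux
  obtain ⟨hu, hmem⟩ := exists_inv_smul_mem_polar hV.1 hV0 hfu
  have hle : |u⁻¹ * B x y| ≤ 1 := by simpa using hx _ hmem
  have : u⁻¹ * B x y ≤ 1 := (le_abs_self _).trans hle
  rw [inv_mul_le_one₀ hu] at this
  exact this.not_gt hux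

theorem polar_inter_subset_closure [TopologicalSpace X] [IsTopologicalAddGroup X]
    [ContinuousSMul ℝ X] [LocallyConvexSpace ℝ X] [TopologicalSpace Y] [IsTopologicalAddGroup Y]
    [ContinuousSMul ℝ Y] [LocallyConvexSpace ℝ Y]
    (hX : ∀ f : StrongDual ℝ X, ∃ y, ∀ x, f x = B x y)
    (hY : ∀ g : StrongDual ℝ Y, ∃ x, ∀ y, g y = B x y) {K L : Set X}
    (hK : AbsConvex ℝ K) (hKc : IsClosed K) (hK0 : K.Nonempty)
    (hL : AbsConvex ℝ L) (hLc : IsClosed L) (hL0 : L.Nonempty) :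
    B.polar (K ∩ L) ⊆ closure (B.polar K + B.polar L) := by
  have hne : (closure (B.polar K + B.polar L)).Nonempty :=
    ((B.polar_nonempty K).add (B.polar_nonempty L)).closure
  have hac : AbsConvex ℝ (closure (B.polar K + B.polar L)) :=
    AbsConvex.closure ⟨(B.polar_AbsConvex K).1.add (B.polar_AbsConvex L).1,
      (B.polar_AbsConvex K).2.add (B.polar_AbsConvex L).2⟩
  rw [← bipolar_eq (B := B.flip) hY hac isClosed_closure hne]
  refine B.polar_antitone (Set.subset_inter ?_ ?_)
  · refine (B.flip.polar_antitone fun y hy => ?_).trans (bipolar_eq hX hK hKc hK0).subset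
    exact subset_closure ⟨y, hy, 0, B.zero_mem_polar L, add_zero y⟩
  · refine (B.flip.polar_antitone fun y hy => ?_).trans (bipolar_eq hX hL hLc hL0).subset
    exact subset_closure ⟨0, B.zero_mem_polar K, y, hy, zero_add y⟩

namespace IsDualPair

variable [TopologicalSpace X] [TopologicalSpace Y]

protected theorem flip (hB : IsDualPair B) : IsDualPair B.flip where
  separatingLeft := LinearMap.flip_separatingLeft.2 hB.separatingRight
  separatingRight := LinearMap.flip_separatingRight.2 hB.separatingLeft
  continuous_left_iff := hB.continuous_right_iff
  continuous_right_iff := hB.continuous_left_iff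

theorem exists_right (hB : IsDualPair B) (f : StrongDual ℝ X) : ∃ y, ∀ x, f x = B x y := by
  obtain ⟨y, hy⟩ := (hB.continuous_left_iff f.toLinearMap).1 f.continuous
  exact ⟨y, LinearMap.congr_fun hy⟩

theorem continuous_left (hB : IsDualPair B) (y : Y) : Continuous fun x => B x y :=
  (hB.continuous_left_iff (B.flip y)).2 ⟨y, rfl⟩

theorem continuous_right (hB : IsDualPair B) (x : X) : Continuous (B x) :=
  hB.flip.continuous_left x

theorem setOf_abs_lt_mem_nhds (hB : IsDualPair B) (x : X) {r : ℝ} (hr : 0 < r) :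
    {y | |B x y| < r} ∈ 𝓝 (0 : Y) :=
  (hB.continuous_right x).abs.continuousAt.preimage_mem_nhds (Iio_mem_nhds (by simpa using hr))

theorem isClosed_weak_of_absConvex [IsTopologicalAddGroup X] [ContinuousSMul ℝ X]
    [LocallyConvexSpace ℝ X] (hB : IsDualPair B) {V : Set X} (hV : AbsConvex ℝ V)
    (hVc : IsClosed V) : IsClosed[weakTopology B] V := by
  rcases V.eq_empty_or_nonempty with rfl | hV0
  · exact @isClosed_empty _ (weakTopology B)
  rw [← bipolar_eq hB.exists_right hV hVc hV0]
  exact B.flip.polar_isClosed _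

end IsDualPair

variable (B) in
/-- The absolutely convex `σ(X, Y)`-compact subsets of `X`, whose polars form a basis of
neighbourhoods of zero for the Mackey topology `τ(Y, X)`. -/
def weakDiscs : Set (Set X) :=
  {K | Convex ℝ K ∧ Balanced ℝ K ∧ @IsCompact X (weakTopology B) K}

theorem add_mem_weakDiscs {K L : Set X} (hK : K ∈ weakDiscs B) (hL : L ∈ weakDiscs B) :
    K + L ∈ weakDiscs B := by
  let := weakTopology B
  have := weak_isTopologicalAddGroup (B := B)
  exact ⟨hK.1.add hL.1, hK.2.1.add hL.2.1, hK.2.2.add hL.2.2⟩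

theorem smul_mem_weakDiscs {K : Set X} (hK : K ∈ weakDiscs B) (c : ℝ) :
    c • K ∈ weakDiscs B := by
  let := weakTopology B
  have := weak_continuousSMul (B := B)
  exact ⟨hK.1.smul c, hK.2.1.smul c, hK.2.2.smul c⟩

variable (B) in
theorem segment_mem_weakDiscs (x : X) :
    (fun t : ℝ => t • x) '' Set.Icc (-1) 1 ∈ weakDiscs B := by
  let := weakTopology B
  have := weak_continuousSMul (B := B)
  refine ⟨(convex_Icc _ _).is_linear_image ⟨fun a b => add_smul a b x, fun c a => mul_smul c a x⟩,
    ?_, isCompact_Icc.image (by fun_prop)⟩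
  rintro a ha _ ⟨_, ⟨t, ht, rfl⟩, rfl⟩
  refine ⟨a * t, ?_, mul_smul a t x⟩
  rw [Set.mem_Icc, ← abs_le, abs_mul]
  exact mul_le_one₀ ha (abs_nonneg t) (abs_le.2 ht)

theorem polar_mem_weakDiscs [TopologicalSpace Y] [IsTopologicalAddGroup Y] [ContinuousSMul ℝ Y]
    (hB : ∀ g : StrongDual ℝ Y, ∃ x, ∀ y, g y = B x y) {W : Set Y} (hW : W ∈ 𝓝 0) :
    B.flip.polar W ∈ weakDiscs B := by
  refine ⟨(B.flip.polar_AbsConvex W).2, (B.flip.polar_AbsConvex W).1, ?_⟩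
  choose r hr hrW using fun y => (absorbent_nhds_zero (𝕜 := ℝ) hW y).exists_pos
  have himg : (fun x y => B x y) '' B.flip.polar W =
      Set.range ((↑) : (Y →ₗ[ℝ] ℝ) → Y → ℝ) ∩ ⋂ w ∈ W, {g | |g w| ≤ 1} := by
    ext g
    simp only [Set.mem_image, Set.mem_inter_iff, Set.mem_range, Set.mem_iInter₂]
    constructor
    · rintro ⟨x, hx, rfl⟩
      exact ⟨⟨B x, rfl⟩, hx⟩
    · rintro ⟨⟨g, rfl⟩, hg⟩
      obtain ⟨x, hx⟩ := hB ⟨g, continuous_of_abs_le_one_of_mem_nhds g hW hg⟩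
      obtain rfl : g = B x := LinearMap.ext hx
      exact ⟨x, hg, rfl⟩
  have hclosed : IsClosed ((fun x y => B x y) '' B.flip.polar W) := by
    rw [himg]
    exact (LinearMap.isClosed_range_coe _ _ _).inter <| isClosed_biInter fun w _ =>
      isClosed_le (continuous_apply w).abs continuous_const
  let := weakTopology B
  have hind : IsInducing fun (x : X) (y : Y) => B x y := ⟨rfl⟩
  refine hind.isCompact_iff.2 ?_
  refine (isCompact_univ_pi fun y => isCompact_Icc (a := -r y) (b := r y)).of_isClosed_subset
    hclosed ?_
  rintro _ ⟨x, hx, rfl⟩ y -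
  obtain ⟨w, hw, hwy⟩ := hrW y (r y) (le_abs_self _) rfl
  rw [Set.mem_Icc, ← abs_le]
  have hBwy : B x y = r y * B x w := by
    rw [← smul_eq_mul, ← map_smul]
    exact congrArg (B x) hwy.symm
  calc |B x y| = r y * |B x w| := by rw [hBwy, abs_mul, abs_of_pos (hr y)]
    _ ≤ r y := mul_le_of_le_one_right (hr y).le (hx w hw)

namespace IsDualPair

variable [tX : TopologicalSpace X] [TopologicalSpace Y]

theorem isClosed_of_mem_weakDiscs (hB : IsDualPair B) {K : Set X} (hK : K ∈ weakDiscs B) :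
    IsClosed K := by
  have hinj : Function.Injective B :=
    LinearMap.ker_eq_bot.1 (LinearMap.separatingLeft_iff_ker_eq_bot.1 hB.separatingLeft)
  have hKw : IsClosed[weakTopology B] K :=
    @IsCompact.isClosed X (weakTopology B) (weak_t2Space hinj) K hK.2.2
  have hle : tX ≤ weakTopology B :=
    continuous_iff_le_induced.1 (continuous_pi hB.continuous_left)
  exact hKw.mono hle

theorem isVonNBounded_of_mem_weakDiscs [IsTopologicalAddGroup X] [ContinuousSMul ℝ X]
    [LocallyConvexSpace ℝ X] (hB : IsDualPair B) {K : Set X} (hK : K ∈ weakDiscs B) :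
    Bornology.IsVonNBounded ℝ K := by
  intro U hU
  obtain ⟨V, hV, hVa, hVc, hVU⟩ := exists_absConvex_isClosed_nhds_add_subset hU
  have hV0 : (0 : X) ∈ V := mem_of_mem_nhds hV
  refine Absorbs.mono_left ?_ ((Set.subset_add_left V hV0).trans hVU)
  exact @absorbs_of_isCompact X _ _ (weakTopology B) weak_isTopologicalAddGroup
    weak_continuousSMul K V hK.2.2 ⟨hK.2.1, hK.1⟩ (hB.isClosed_weak_of_absConvex hVa hVc) hVa
    (absorbent_nhds_zero hV)

end IsDualPair

end Duality

section Mackey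

variable {X Y : Type*} [AddCommGroup X] [Module ℝ X] [AddCommGroup Y] [Module ℝ Y]

theorem directedOn_weakDiscs (B : X →ₗ[ℝ] Y →ₗ[ℝ] ℝ) : DirectedOn (· ⊆ ·) (weakDiscs B) := by
  intro K hK L hL
  rcases K.eq_empty_or_nonempty with rfl | hK0
  · exact ⟨L, hL, L.empty_subset, subset_rfl⟩
  rcases L.eq_empty_or_nonempty with rfl | hL0
  · exact ⟨K, hK, subset_rfl, K.empty_subset⟩
  exact ⟨K + L, add_mem_weakDiscs hK hL, Set.subset_add_left K (hL.2.1.zero_mem hL0),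
    Set.subset_add_right L (hK.2.1.zero_mem hK0)⟩

variable (B : X →ₗ[ℝ] Y →ₗ[ℝ] ℝ)

theorem mackey_isTopologicalAddGroup : @IsTopologicalAddGroup Y (mackeyTopology B) _ := by
  let ofFun : Y →+ UniformOnFun X ℝ (weakDiscs B) :=
    { toFun := fun y => UniformOnFun.ofFun (weakDiscs B) fun x => B x y
      map_zero' := by simp only [map_zero]; rfl
      map_add' := fun y z => by simp only [map_add]; rfl }
  let := mackeyTopology B
  exact IsInducing.topologicalAddGroup ofFun ⟨rfl⟩

theorem mackey_continuousSMul : @ContinuousSMul ℝ Y _ _ (mackeyTopology B) := by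
  let := mackeyTopology B
  refine UniformOnFun.continuousSMul_induced_of_image_bounded (𝔖 := weakDiscs B) ℝ X ℝ Y
    (LinearMap.ltoFun ℝ X ℝ ℝ ∘ₗ B.flip) ⟨rfl⟩ fun y K hK => ?_
  let := weakTopology B
  exact (hK.2.2.image (weak_continuous_apply y)).isVonNBounded ℝ

theorem mackey_hasBasis : (@nhds Y (mackeyTopology B) 0).HasBasis
    (fun p : Set X × ℝ => p.1 ∈ weakDiscs B ∧ 0 < p.2)
    fun p => {y | ∀ x ∈ p.1, |B x y| < p.2} := by
  have h := (UniformOnFun.hasBasis_nhds_zero_of_basis (weakDiscs B)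
    ⟨_, segment_mem_weakDiscs B 0⟩ (directedOn_weakDiscs B)
    (Metric.nhds_basis_ball (x := (0 : ℝ)))).comap
      (fun y : Y => UniformOnFun.ofFun (weakDiscs B) (fun x : X => B x y))
  rw [nhds_induced]
  convert h using 1
  · simp only [map_zero]
    rfl
  · ext p y
    simp only [Set.mem_ofPred_eq, Set.preimage_ofPred_eq, UniformOnFun.toFun_ofFun,
      mem_ball_zero_iff, Real.norm_eq_abs]

theorem mackey_locallyConvexSpace : @LocallyConvexSpace ℝ Y _ _ _ _ (mackeyTopology B) := by
  let := mackeyTopology B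
  have := mackey_isTopologicalAddGroup B
  refine LocallyConvexSpace.ofBasisZero ℝ Y _ _ (mackey_hasBasis B) ?_
  rintro ⟨K, ε⟩ -
  have : {y | ∀ x ∈ K, |B x y| < ε} = ⋂ x ∈ K, B x ⁻¹' Metric.ball 0 ε := by
    ext y
    simp
  rw [this]
  exact convex_iInter₂ fun x _ => (convex_ball 0 ε).linear_preimage (B x)

variable {B}

theorem polar_mem_mackey_nhds {K : Set X} (hK : K ∈ weakDiscs B) :
    B.polar K ∈ @nhds Y (mackeyTopology B) 0 :=
  mem_of_superset ((mackey_hasBasis B).mem_of_mem (i := (K, 1)) ⟨hK, one_pos⟩)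
    fun _ hy x hx => (hy x hx).le

theorem exists_polar_subset_of_mem_mackey_nhds {W : Set Y}
    (hW : W ∈ @nhds Y (mackeyTopology B) 0) :
    ∃ K ∈ weakDiscs B, K.Nonempty ∧ B.polar K ⊆ W := by
  obtain ⟨⟨K, ε⟩, ⟨hK, hε⟩, hKW⟩ := (mackey_hasBasis B).mem_iff.1 hW
  rcases K.eq_empty_or_nonempty with rfl | hK0
  · refine ⟨_, segment_mem_weakDiscs B 0, ⟨_, 0, by simp, rfl⟩, fun y _ => hKW (by simp)⟩
  refine ⟨_, smul_mem_weakDiscs hK (2 / ε), hK0.smul_set, fun y hy => hKW fun x hx => ?_⟩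
  have h1 := hy _ (Set.smul_mem_smul_set hx)
  rw [map_smul, LinearMap.smul_apply, smul_eq_mul, norm_mul, Real.norm_of_nonneg (by positivity),
    div_mul_eq_mul_div, div_le_one hε, Real.norm_eq_abs] at h1
  dsimp only
  linarith [abs_nonneg (B x y)]

theorem exists_mem_eq_of_abs_le_one_on_polar {K : Set X} (hK : K ∈ weakDiscs B)
    (hK0 : K.Nonempty) {g : Y →ₗ[ℝ] ℝ} (hg : ∀ y ∈ B.polar K, |g y| ≤ 1) : ∃ x ∈ K, B x = g := by
  let eval : Module.Dual ℝ Y →ₗ[ℝ] Y →ₗ[ℝ] ℝ := LinearMap.id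
  let := weakTopology eval
  have := weak_isTopologicalAddGroup (B := eval)
  have := weak_continuousSMul (B := eval)
  have := weak_locallyConvexSpace (B := eval)
  have := weak_t2Space (B := eval) Function.injective_id
  have hcomp : IsCompact (B '' K) := by
    let := weakTopology B
    exact hK.2.2.image (WeakBilin.continuous_of_continuous_eval eval weak_continuous_apply)
  have hac : AbsConvex ℝ (B '' K) := ⟨fun a ha => by
    rw [← image_smul_set]
    exact Set.image_mono (hK.2.1 a ha), hK.1.linear_image B⟩
  have heval (f : StrongDual ℝ (Module.Dual ℝ Y)) : ∃ y, ∀ φ, f φ = eval φ y := by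
    obtain ⟨y, hy⟩ := LinearMap.dualEmbedding_surjective eval f
    exact ⟨y, fun φ => by rw [← hy]; rfl⟩
  have hmem : g ∈ eval.flip.polar (eval.polar (B '' K)) :=
    fun y hy => hg y fun x hx => hy (B x) (Set.mem_image_of_mem B hx)
  rwa [bipolar_eq heval hac hcomp.isClosed (hK0.image B)] at hmem

theorem mackey_continuous_iff (g : Y →ₗ[ℝ] ℝ) :
    Continuous[mackeyTopology B, _] g ↔ ∃ x : X, g = B x := by
  let := mackeyTopology B
  have := mackey_isTopologicalAddGroup B
  have := mackey_continuousSMul B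
  constructor
  · intro hg
    have hW : g ⁻¹' Metric.closedBall 0 1 ∈ 𝓝 (0 : Y) :=
      hg.continuousAt.preimage_mem_nhds (by simpa using Metric.closedBall_mem_nhds 0 one_pos)
    obtain ⟨K, hK, hK0, hKg⟩ := exists_polar_subset_of_mem_mackey_nhds hW
    obtain ⟨x, -, hx⟩ := exists_mem_eq_of_abs_le_one_on_polar hK hK0 fun y hy => by
      simpa using hKg hy
    exact ⟨x, hx.symm⟩
  · rintro ⟨x, rfl⟩
    refine continuous_of_abs_le_one_of_mem_nhds (B x)
      (polar_mem_mackey_nhds (segment_mem_weakDiscs B x)) fun y hy => ?_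
    exact hy x ⟨1, by simp, one_smul ℝ x⟩

theorem IsDualPair.mackey_flip [TopologicalSpace X] [TopologicalSpace Y] (hB : IsDualPair B) :
    @IsDualPair Y X _ _ (mackeyTopology B) _ _ _ B.flip :=
  @IsDualPair.mk Y X _ _ (mackeyTopology B) _ _ _ B.flip
    hB.flip.separatingLeft hB.flip.separatingRight mackey_continuous_iff hB.continuous_left_iff

end Mackey

section Conjugate

theorem eq_of_forall_le_coe_iff {a b : EReal} (h : ∀ r : ℝ, a ≤ r ↔ b ≤ r) : a = b :=
  le_antisymm (EReal.le_of_forall_lt_iff_le.1 fun r hr => (h r).2 hr.le)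
    (EReal.le_of_forall_lt_iff_le.1 fun r hr => (h r).1 hr.le)

theorem coe_sub_le_coe_iff {a : EReal} {b r : ℝ} :
    (b : EReal) - a ≤ r ↔ ∀ s : ℝ, a ≤ s → b - s ≤ r := by
  induction a using EReal.rec with
  | bot =>
    simp only [EReal.coe_sub_bot, top_le_iff, EReal.coe_ne_top, bot_le, forall_const, false_iff,
      not_forall, not_le]
    exact ⟨b - r - 1, by linarith⟩
  | top => simp
  | coe a =>
    rw [← EReal.coe_sub, EReal.coe_le_coe_iff]
    exact ⟨fun h s hs => by linarith [EReal.coe_le_coe_iff.1 hs], fun h => h a le_rfl⟩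

theorem mk_toReal_mem_epi {E : Type*} {f : E → EReal} {x : E} (hx : x ∈ dom f) :
    (x, (f x).toReal) ∈ epi f :=
  EReal.le_coe_toReal (ne_of_lt hx)

theorem toReal_le_of_mem_epi {E : Type*} {f : E → EReal} {p : E × ℝ} (hf : f p.1 ≠ ⊥)
    (hp : p ∈ epi f) : (f p.1).toReal ≤ p.2 := by
  rw [← EReal.coe_le_coe_iff, EReal.coe_toReal (ne_top_of_le_ne_top (EReal.coe_ne_top _) hp) hf]
  exact hp

theorem fst_mem_dom_of_mem_epi {E : Type*} {f : E → EReal} {p : E × ℝ} (hp : p ∈ epi f) :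
    p.1 ∈ dom f :=
  lt_of_le_of_lt hp (EReal.coe_lt_top p.2)

variable {X Y : Type*} [AddCommGroup X] [Module ℝ X] [AddCommGroup Y] [Module ℝ Y]
  {B : X →ₗ[ℝ] Y →ₗ[ℝ] ℝ} {f : X → EReal}

theorem conj_le_coe_iff {y : Y} {r : ℝ} :
    conj B f y ≤ r ↔ ∀ p ∈ epi f, B p.1 y - p.2 ≤ r := by
  rw [conj, iSup_le_iff, Prod.forall]
  exact forall_congr' fun x => coe_sub_le_coe_iff

theorem conj_ne_bot (hf : (dom f).Nonempty) (y : Y) : conj B f y ≠ ⊥ := by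
  obtain ⟨x, hx⟩ := hf
  intro h
  have h1 := conj_le_coe_iff.1 (h.trans_le (bot_le (a := ((B x y - (f x).toReal - 1 : ℝ) : EReal))))
    _ (mk_toReal_mem_epi hx)
  linarith

theorem convex_epi_conj (B : X →ₗ[ℝ] Y →ₗ[ℝ] ℝ) (f : X → EReal) : Convex ℝ (epi (conj B f)) := by
  have hepi : epi (conj B f) = ⋂ p ∈ epi f, {q : Y × ℝ | B p.1 q.1 - q.2 ≤ p.2} := by
    ext q
    simp only [epi, Set.mem_ofPred_eq, conj_le_coe_iff, Set.mem_iInter, sub_le_comm]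
  rw [hepi]
  exact convex_iInter₂ fun p _ =>
    convex_halfSpace_le (B p.1 ∘ₗ LinearMap.fst ℝ Y ℝ - LinearMap.snd ℝ Y ℝ).isLinear p.2

theorem lowerSemicontinuous_conj (B : X →ₗ[ℝ] Y →ₗ[ℝ] ℝ) (f : X → EReal) :
    @LowerSemicontinuous _ _ (weakTopology B.flip) _ (conj B f) := by
  let := weakTopology B.flip
  refine lowerSemicontinuous_iSup fun x => Continuous.lowerSemicontinuous ?_
  have hcont : Continuous fun y => B x y := weak_continuous_apply (B := B.flip) x
  induction f x using EReal.rec with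
  | bot => simpa using continuous_const
  | top => simpa using continuous_const
  | coe a =>
    simp only [← EReal.coe_sub]
    exact continuous_coe_real_ereal.comp (hcont.sub continuous_const)

theorem exists_conj_le_of_separation {x : X} {y : Y} {α r u : ℝ} (hα : 0 < α)
    (hepi : ∀ p ∈ epi f, B p.1 y - α * p.2 < u) (hx : u < B x y - α * r) :
    ∃ (y : Y) (c : ℝ), conj B f y ≤ c ∧ r < B x y - c := by
  refine ⟨α⁻¹ • y, α⁻¹ * u, conj_le_coe_iff.2 fun p hp => ?_, ?_⟩
  · rw [map_smul, smul_eq_mul, le_inv_mul_iff₀ hα, mul_sub, mul_inv_cancel_left₀ hα.ne']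
    exact (hepi p hp).le
  · rw [map_smul, smul_eq_mul, ← mul_sub, lt_inv_mul_iff₀ hα]
    linarith

section Separation

variable [TopologicalSpace X] [TopologicalSpace Y]

theorem IsDualPair.exists_right_prod (hB : IsDualPair B) (ℓ : StrongDual ℝ (X × ℝ)) :
    ∃ (y : Y) (α : ℝ), ∀ p : X × ℝ, ℓ p = B p.1 y + p.2 * α := by
  obtain ⟨y, hy⟩ := hB.exists_right (ℓ.comp (ContinuousLinearMap.inl ℝ X ℝ))
  refine ⟨y, ℓ (0, 1), fun p => ?_⟩
  calc ℓ p = ℓ ((p.1, 0) + p.2 • (0, 1)) := by simp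
    _ = B p.1 y + p.2 * ℓ (0, 1) := by rw [map_add, map_smul, smul_eq_mul, ← hy]; rfl

variable [IsTopologicalAddGroup X] [ContinuousSMul ℝ X] [LocallyConvexSpace ℝ X]

theorem exists_separation_of_notMem_epi (hB : IsDualPair B) (hf : IsGammaZero f) {q : X × ℝ}
    (hq : q ∉ epi f) : ∃ (y : Y) (α u : ℝ), 0 ≤ α ∧ (∀ p ∈ epi f, B p.1 y - α * p.2 < u) ∧
      u < B q.1 y - α * q.2 := by
  obtain ⟨ℓ, u, hepi, hqu⟩ := geometric_hahn_banach_closed_point hf.convex_epi hf.isClosed_epi hq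
  obtain ⟨y, α, hℓ⟩ := hB.exists_right_prod ℓ
  simp only [hℓ] at hepi hqu
  have hα : α ≤ 0 := by
    by_contra! hα
    obtain ⟨x₁, hx₁⟩ := hf.dom_nonempty
    let s := max (f x₁).toReal ((u - B x₁ y) / α)
    have hs : (u - B x₁ y) / α ≤ s := le_max_right _ _
    have hmem : (x₁, s) ∈ epi f :=
      le_trans (mk_toReal_mem_epi hx₁) (EReal.coe_le_coe_iff.2 (le_max_left _ _))
    rw [div_le_iff₀ hα] at hs
    linarith [hepi _ hmem]
  exact ⟨y, -α, u, by linarith, fun p hp => by linarith [hepi p hp], by linarith⟩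

theorem dom_conj_nonempty (hB : IsDualPair B) (hf : IsGammaZero f) :
    (dom (conj B f)).Nonempty := by
  obtain ⟨x, hx⟩ := hf.dom_nonempty
  have hq : (x, (f x).toReal - 1) ∉ epi f := fun hq => by
    linarith [toReal_le_of_mem_epi (hf.ne_bot x) hq]
  obtain ⟨y, α, u, hα, hepi, hlt⟩ := exists_separation_of_notMem_epi hB hf hq
  have hα' : 0 < α := by nlinarith [hα, hepi _ (mk_toReal_mem_epi hx)]
  obtain ⟨z, c, hc, -⟩ := exists_conj_le_of_separation hα' hepi hlt
  exact ⟨z, hc.trans_lt (EReal.coe_lt_top c)⟩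

theorem exists_conj_le_of_notMem_epi (hB : IsDualPair B) (hf : IsGammaZero f) {q : X × ℝ}
    (hq : q ∉ epi f) : ∃ (y : Y) (c : ℝ), conj B f y ≤ c ∧ q.2 < B q.1 y - c := by
  obtain ⟨y, α, u, hα, hepi, hlt⟩ := exists_separation_of_notMem_epi hB hf hq
  rcases hα.lt_or_eq with hα | rfl
  · exact exists_conj_le_of_separation hα hepi hlt
  -- A vertical hyperplane is tilted by a large multiple of it added to some affine minorant.
  simp only [zero_mul, sub_zero] at hepi hlt
  obtain ⟨y₁, hy₁⟩ := dom_conj_nonempty hB hf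
  have hc₁ := conj_le_coe_iff.1 (mk_toReal_mem_epi hy₁)
  set c₁ := (conj B f y₁).toReal
  obtain ⟨n, hn⟩ := exists_nat_gt ((q.2 - (B q.1 y₁ - c₁)) / (B q.1 y - u))
  rw [div_lt_iff₀ (sub_pos.2 hlt)] at hn
  refine ⟨y₁ + (n : ℝ) • y, c₁ + n * u, conj_le_coe_iff.2 fun p hp => ?_, ?_⟩
  · have hvert := mul_le_mul_of_nonneg_left (hepi p hp).le n.cast_nonneg
    simp only [map_add, map_smul, smul_eq_mul]
    linarith [hc₁ p hp]
  · simp only [map_add, map_smul, smul_eq_mul]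
    linarith

theorem conj_conj (hB : IsDualPair B) (hf : IsGammaZero f) : conj B.flip (conj B f) = f := by
  ext x
  refine eq_of_forall_le_coe_iff fun r => ?_
  rw [conj_le_coe_iff]
  refine ⟨fun h => ?_, fun h q hq => ?_⟩
  · by_contra hr
    obtain ⟨y, c, hc, hlt⟩ := exists_conj_le_of_notMem_epi hB hf (q := (x, r)) hr
    have hle : B x y - c ≤ r := h (y, c) hc
    exact hle.not_gt hlt
  · have hle : B x q.1 - r ≤ q.2 := conj_le_coe_iff.1 hq (x, r) h
    rw [LinearMap.flip_apply]
    linarith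

theorem lowerSemicontinuous_weak (hB : IsDualPair B) (hf : IsGammaZero f) :
    @LowerSemicontinuous _ _ (weakTopology B) _ f := by
  have hlsc := lowerSemicontinuous_conj B.flip (conj B f)
  rwa [conj_conj hB hf] at hlsc

end Separation

end Conjugate

section Subdifferential

variable {X Y : Type*} [AddCommGroup X] [Module ℝ X] [AddCommGroup Y] [Module ℝ Y]
  {B : X →ₗ[ℝ] Y →ₗ[ℝ] ℝ} {f : X → EReal}

/-- The `ε`-subdifferential of `f` at `x`, the approximate subgradients out of which the exact
ones are built. The inequality `⟨u - x, y⟩ ≤ f u - f x + ε` is stated over the epigraph to stay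
within the real numbers. -/
def approxSubdiff (B : X →ₗ[ℝ] Y →ₗ[ℝ] ℝ) (f : X → EReal) (ε : ℝ) (x : X) : Set Y :=
  {y | x ∈ dom f ∧ ∀ p ∈ epi f, B (p.1 - x) y ≤ p.2 - (f x).toReal + ε}

theorem approxSubdiff_zero (hf : ∀ x, f x ≠ ⊥) (x : X) :
    approxSubdiff B f 0 x = subdiff B f x := by
  ext y
  refine and_congr_right fun hx => ?_
  rw [Prod.forall]
  refine forall_congr' fun u => ?_
  obtain ⟨a, ha⟩ : ∃ a : ℝ, f x = a := ⟨_, (EReal.coe_toReal hx.ne (hf x)).symm⟩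
  simp only [ha, EReal.toReal_coe, add_zero]
  induction hu : f u using EReal.rec with
  | bot => exact absurd hu (hf u)
  | top => simp [epi, hu]
  | coe b =>
    simp only [epi, Set.mem_ofPred_eq, hu, ← EReal.coe_sub, EReal.coe_le_coe_iff]
    exact ⟨fun h => h b le_rfl, fun h s hs => by linarith⟩

theorem mem_approxSubdiff_iff_mem_epi {ε : ℝ} {x : X} {y : Y} : y ∈ approxSubdiff B f ε x ↔
    x ∈ dom f ∧ (y, B x y - (f x).toReal + ε) ∈ epi (conj B f) := by
  refine and_congr_right fun _ => Iff.trans (forall₂_congr fun p _ => ?_) conj_le_coe_iff.symm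
  rw [map_sub, LinearMap.sub_apply]
  constructor <;> intro h <;> linarith

theorem mem_approxSubdiff_iff {ε : ℝ} {x : X} {y : Y} : y ∈ approxSubdiff B f ε x ↔
    x ∈ dom f ∧ y ∈ dom (conj B f) ∧ (f x).toReal + (conj B f y).toReal ≤ B x y + ε := by
  rw [mem_approxSubdiff_iff_mem_epi]
  refine and_congr_right fun hx => ⟨fun h => ⟨fst_mem_dom_of_mem_epi h, ?_⟩, fun ⟨hy, h⟩ => ?_⟩
  · linarith [toReal_le_of_mem_epi (conj_ne_bot ⟨x, hx⟩ y) h]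
  · exact le_trans (mk_toReal_mem_epi hy) (EReal.coe_le_coe_iff.2 (by linarith [h]))

theorem nonneg_of_mem_approxSubdiff {ε : ℝ} {x : X} {y : Y} (hy : y ∈ approxSubdiff B f ε x) :
    0 ≤ ε := by
  simpa using hy.2 _ (mk_toReal_mem_epi hy.1)

theorem mem_approxSubdiff_conj_iff [TopologicalSpace X] [IsTopologicalAddGroup X]
    [ContinuousSMul ℝ X] [LocallyConvexSpace ℝ X] [TopologicalSpace Y] (hB : IsDualPair B)
    (hf : IsGammaZero f) {ε : ℝ} {x : X} {y : Y} :
    x ∈ approxSubdiff B.flip (conj B f) ε y ↔ y ∈ approxSubdiff B f ε x := by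
  rw [mem_approxSubdiff_iff, mem_approxSubdiff_iff, conj_conj hB hf, LinearMap.flip_apply,
    and_left_comm, add_comm]

theorem mem_subdiff_of_mem_subdiff_conj [TopologicalSpace X] [IsTopologicalAddGroup X]
    [ContinuousSMul ℝ X] [LocallyConvexSpace ℝ X] [TopologicalSpace Y] (hB : IsDualPair B)
    (hf : IsGammaZero f) {x : X} {y : Y} (h : x ∈ subdiff B.flip (conj B f) y) :
    y ∈ subdiff B f x := by
  rw [← approxSubdiff_zero (conj_ne_bot hf.dom_nonempty)] at h
  rw [← approxSubdiff_zero hf.ne_bot]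
  exact (mem_approxSubdiff_conj_iff hB hf).1 h

end Subdifferential

section NormalCone

theorem exists_forall_nonpos_of_notMem_closure {E : Type*} [AddCommGroup E] [Module ℝ E]
    [TopologicalSpace E] [IsTopologicalAddGroup E] [ContinuousSMul ℝ E] [LocallyConvexSpace ℝ E]
    {C : ConvexCone ℝ E} (hC : (C : Set E).Nonempty) {q : E} (hq : q ∉ closure (C : Set E)) :
    ∃ ℓ : StrongDual ℝ E, (∀ p ∈ C, ℓ p ≤ 0) ∧ 0 < ℓ q := by
  obtain ⟨C', hC'⟩ := CanLift.prf (β := ProperCone ℝ E) C.closure ⟨hC.closure, isClosed_closure⟩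
  have hmem : ∀ p, p ∈ C' ↔ p ∈ closure (C : Set E) := fun p => by
    rw [← C.coe_closure, ← hC']; rfl
  obtain ⟨ℓ, hℓ, hℓq⟩ := C'.hyperplane_separation_point (mt (hmem q).1 hq)
  exact ⟨-ℓ, fun p hp => neg_nonpos.2 (hℓ p ((hmem p).2 (subset_closure hp))), neg_pos.2 hℓq⟩

variable {X Y : Type*} [AddCommGroup X] [Module ℝ X] [AddCommGroup Y] [Module ℝ Y]
  {B : X →ₗ[ℝ] Y →ₗ[ℝ] ℝ} {f : X → EReal} {x₀ : X} {v : Y}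

theorem convex_approxSubdiff_graph (B : X →ₗ[ℝ] Y →ₗ[ℝ] ℝ) (f : X → EReal) (x₀ : X) :
    Convex ℝ {q : Y × ℝ | q.1 ∈ approxSubdiff B f q.2 x₀} := by
  rintro q ⟨hx₀, hq⟩ r ⟨-, hr⟩ a b ha hb hab
  refine ⟨hx₀, fun p hp => ?_⟩
  have haq := mul_le_mul_of_nonneg_left (hq p hp) ha
  have hbr := mul_le_mul_of_nonneg_left (hr p hp) hb
  obtain rfl := eq_sub_of_add_eq hab
  simp only [Prod.fst_add, Prod.smul_fst, Prod.snd_add, Prod.smul_snd, map_add, map_smul,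
    smul_eq_mul]
  linarith

variable [TopologicalSpace X] [IsTopologicalAddGroup X] [ContinuousSMul ℝ X]
  [LocallyConvexSpace ℝ X] [TopologicalSpace Y]

theorem add_mem_sublevel_of_forall_approxSubdiff (hB : IsDualPair B) (hf : IsGammaZero f)
    (hx₀ : x₀ ∈ dom f) {z : X} (hz : ∀ ε, ∀ y ∈ approxSubdiff B f ε x₀, B z y ≤ ε) :
    x₀ + z ∈ sublevel f (f x₀) := by
  obtain ⟨a, ha⟩ : ∃ a : ℝ, f x₀ = a := ⟨_, (EReal.coe_toReal hx₀.ne (hf.ne_bot x₀)).symm⟩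
  change f (x₀ + z) ≤ f x₀
  rw [ha, ← conj_conj hB hf, conj_le_coe_iff]
  intro q hq
  have hmem : q.1 ∈ approxSubdiff B f (q.2 + a - B x₀ q.1) x₀ :=
    mem_approxSubdiff_iff_mem_epi.2 ⟨hx₀, by simpa [ha] using hq⟩
  have hle := hz _ _ hmem
  simp only [LinearMap.flip_apply, map_add]
  linarith

variable [IsTopologicalAddGroup Y] [ContinuousSMul ℝ Y] [LocallyConvexSpace ℝ Y]

theorem mem_closure_hull_of_mem_normalCone (hB : IsDualPair B) (hf : IsGammaZero f)
    (hx₀ : x₀ ∈ dom f) (hv : v ∈ normalCone B (sublevel f (f x₀)) x₀) :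
    (v, (0 : ℝ)) ∈
      closure (ConvexCone.hull ℝ {q : Y × ℝ | q.1 ∈ approxSubdiff B f q.2 x₀} : Set (Y × ℝ)) := by
  obtain ⟨y₁, ε₁, hy₁⟩ : ∃ y₁ ε₁, ∀ ε, ε₁ ≤ ε → y₁ ∈ approxSubdiff B f ε x₀ := by
    obtain ⟨y₁, hy₁⟩ := dom_conj_nonempty hB hf
    exact ⟨y₁, (f x₀).toReal + (conj B f y₁).toReal - B x₀ y₁, fun ε hε =>
      mem_approxSubdiff_iff.2 ⟨hx₀, hy₁, by linarith⟩⟩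
  by_contra hcon
  obtain ⟨ℓ, hC, hℓv⟩ := exists_forall_nonpos_of_notMem_closure
    ⟨(y₁, ε₁), ConvexCone.subset_hull (hy₁ ε₁ le_rfl)⟩ hcon
  obtain ⟨x, α, hℓ⟩ := hB.flip.exists_right_prod ℓ
  have hle : ∀ ε, ∀ y ∈ approxSubdiff B f ε x₀, B x y + ε * α ≤ 0 := fun ε y hy => by
    simpa [hℓ] using hC (y, ε) (ConvexCone.subset_hull hy)
  have hxv : 0 < B x v := by simpa [hℓ] using hℓv
  have hα : α ≤ 0 := by
    by_contra! hα
    have hlarge : (1 - B x y₁) / α ≤ max ε₁ ((1 - B x y₁) / α) := le_max_right _ _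
    rw [div_le_iff₀ hα] at hlarge
    linarith [hle _ y₁ (hy₁ _ (le_max_left ε₁ ((1 - B x y₁) / α)))]
  have hα' : 0 < 1 - α := by linarith
  have hmem : x₀ + (1 - α)⁻¹ • x ∈ sublevel f (f x₀) := by
    refine add_mem_sublevel_of_forall_approxSubdiff hB hf hx₀ fun ε y hy => ?_
    rw [map_smul, LinearMap.smul_apply, smul_eq_mul, inv_mul_le_iff₀ hα']
    linarith [hle ε y hy, nonneg_of_mem_approxSubdiff hy]
  have hneg := hv _ hmem
  rw [add_sub_cancel_left, map_smul, LinearMap.smul_apply, smul_eq_mul] at hneg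
  exact hneg.not_gt (mul_pos (inv_pos.2 hα') hxv)

/-- The triples `(μ, ε, y)` with `μ > 0` and `y` an `ε`-subgradient of `f` at `x₀`, along which
`μ y → v` and `μ ε → 0`. -/
def approxFilter (B : X →ₗ[ℝ] Y →ₗ[ℝ] ℝ) (f : X → EReal) (x₀ : X) (v : Y) : Filter (ℝ × ℝ × Y) :=
  comap (fun p => (p.1 • p.2.2, p.1 * p.2.1)) (𝓝 (v, 0)) ⊓
    𝓟 {p | 0 < p.1 ∧ p.2.2 ∈ approxSubdiff B f p.2.1 x₀}

theorem approxFilter_neBot (hB : IsDualPair B) (hf : IsGammaZero f)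
    (hx₀ : x₀ ∈ dom f) (hv : v ∈ normalCone B (sublevel f (f x₀)) x₀) :
    (approxFilter B f x₀ v).NeBot := by
  refine inf_principal_neBot_iff.2 fun U ⟨W, hW, hWU⟩ => ?_
  obtain ⟨q, hqW, hq⟩ :=
    mem_closure_iff_nhds.1 (mem_closure_hull_of_mem_normalCone hB hf hx₀ hv) W hW
  obtain ⟨μ, hμ, ⟨y, ε⟩, hy, rfl⟩ :=
    (ConvexCone.mem_hull_of_convex (convex_approxSubdiff_graph B f x₀)).1 hq
  exact ⟨(μ, ε, y), hWU hqW, hμ, hy⟩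

end NormalCone

section Sandwich

theorem exists_sandwich_of_interior_nonempty {V : Type*} [AddCommGroup V] [Module ℝ V]
    [TopologicalSpace V] [IsTopologicalAddGroup V] [ContinuousSMul ℝ V] {C S : Set (V × ℝ)}
    (hC : Convex ℝ C) (hS : Convex ℝ S) (hSC : ∀ v s r, (v, s) ∈ C → (v, r) ∈ S → r ≤ s)
    {v₀ : V} {a r₀ : ℝ} (ha : (v₀, a) ∈ interior C) (hr₀ : (v₀, r₀) ∈ S) :
    ∃ (φ : StrongDual ℝ V) (c : ℝ), (∀ p ∈ C, φ p.1 + c ≤ p.2) ∧ ∀ q ∈ S, q.2 ≤ φ q.1 + c := by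
  have hlt : ∀ v s r, (v, s) ∈ interior C → (v, r) ∈ S → r < s := by
    intro v s r hs hr
    have hcont : Continuous fun s' : ℝ => (v, s') := by fun_prop
    have hnear : ∀ᶠ s' in 𝓝[<] s, (v, s') ∈ C :=
      (hcont.continuousAt.eventually (mem_interior_iff_mem_nhds.1 hs)).filter_mono
        nhdsWithin_le_nhds
    obtain ⟨s', hs'C, hs'⟩ := (hnear.and self_mem_nhdsWithin).exists
    exact (hSC v s' r hs'C hr).trans_lt hs'
  obtain ⟨ℓ, u, hint, hSu⟩ := geometric_hahn_banach_open hC.interior isOpen_interior hS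
    (Set.disjoint_left.2 fun p hp hpS => (hlt p.1 p.2 p.2 hp hpS).false)
  have hCu : ∀ p ∈ C, ℓ p ≤ u := fun p hp => by
    refine closure_minimal (fun x hx => (hint x hx).le) (isClosed_Iic.preimage ℓ.continuous) ?_
    rw [hC.closure_interior_eq_closure_of_nonempty_interior ⟨_, ha⟩]
    exact subset_closure hp
  let φ := ℓ.comp (ContinuousLinearMap.inl ℝ V ℝ)
  let α := -ℓ (0, 1)
  have hℓ : ∀ p, ℓ p = φ p.1 - α * p.2 := fun p =>
    calc ℓ p = ℓ ((p.1, 0) + p.2 • (0, 1)) := by simp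
      _ = φ p.1 - α * p.2 := by rw [map_add, map_smul, smul_eq_mul]; simp [φ, α, mul_comm]
  simp only [hℓ] at hint hSu hCu
  have hα : 0 < α := by nlinarith [hint _ ha, hSu _ hr₀, hlt _ _ _ ha hr₀]
  refine ⟨α⁻¹ • φ, -(α⁻¹ * u), fun p hp => ?_, fun q hq => ?_⟩
  · change α⁻¹ * φ p.1 + _ ≤ _
    rw [← sub_eq_add_neg, ← mul_sub, inv_mul_le_iff₀ hα]
    linarith [hCu p hp]
  · change _ ≤ α⁻¹ * φ q.1 + _
    rw [← sub_eq_add_neg, ← mul_sub, le_inv_mul_iff₀ hα]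
    linarith [hSu q hq]

variable {E : Type*} [AddCommGroup E] [Module ℝ E] [TopologicalSpace E]
  [IsTopologicalAddGroup E] {f : E → EReal} {e : E}

theorem mk_mem_interior_preimage_epi (he : e ∈ dom f)
    (hcont : ContinuousWithinAt f (affineSpan ℝ (dom f)) e) {a : ℝ} (ha : f e < a) :
    ((0 : (affineSpan ℝ (dom f)).direction), a + 1) ∈
      interior {p : (affineSpan ℝ (dom f)).direction × ℝ | (e + (p.1 : E), p.2) ∈ epi f} := by
  have heL := subset_affineSpan ℝ _ he
  have htend : Tendsto (fun v : (affineSpan ℝ (dom f)).direction => e + (v : E)) (𝓝 0)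
      (𝓝[affineSpan ℝ (dom f)] e) := by
    refine tendsto_nhdsWithin_iff.2 ⟨?_, Eventually.of_forall fun v => ?_⟩
    · exact Continuous.tendsto' (by fun_prop) _ _ (by simp)
    · rw [add_comm]
      exact AffineSubspace.vadd_mem_of_mem_direction v.2 heL
  rw [mem_interior_iff_mem_nhds]
  filter_upwards [(htend.eventually (hcont.eventually_lt_const ha)).prod_nhds
    (lt_mem_nhds (lt_add_one a))] with p hp
  exact hp.1.le.trans (EReal.coe_le_coe_iff.2 hp.2.le)

variable [ContinuousSMul ℝ E] [LocallyConvexSpace ℝ E]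

theorem exists_sandwich_of_continuousWithinAt (hconv : Convex ℝ (epi f)) (he : e ∈ dom f)
    (hcont : ContinuousWithinAt f (affineSpan ℝ (dom f)) e) {S : Set (E × ℝ)} (hS : Convex ℝ S)
    (hfS : ∀ x s r, (x, s) ∈ epi f → (x, r) ∈ S → r ≤ s) {r₀ : ℝ} (hr₀ : (e, r₀) ∈ S) :
    ∃ (φ : StrongDual ℝ E) (c : ℝ), (∀ p ∈ epi f, φ p.1 + c ≤ p.2) ∧
      ∀ q ∈ S, q.1 ∈ affineSpan ℝ (dom f) → q.2 ≤ φ q.1 + c := by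
  let M := (affineSpan ℝ (dom f)).direction
  let ι : M × ℝ →ₗ[ℝ] E × ℝ := M.subtype.prodMap LinearMap.id
  have hpre : ∀ {C : Set (E × ℝ)}, Convex ℝ C →
      Convex ℝ {p : M × ℝ | (e + (p.1 : E), p.2) ∈ C} := fun hC => by
    have := (hC.translate_preimage_right (e, 0)).linear_preimage ι
    simpa [Set.preimage, ι] using this
  obtain ⟨a, ha, -⟩ := EReal.lt_iff_exists_real_btwn.1 he
  obtain ⟨φ, c, hC, hSφ⟩ := exists_sandwich_of_interior_nonempty (hpre hconv) (hpre hS)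
    (fun v s r => hfS _ s r) (mk_mem_interior_preimage_epi he hcont ha)
    (r₀ := r₀) (by simpa using hr₀)
  obtain ⟨ψ, hψ⟩ := StrongDual.exists_extension M φ
  have hM : ∀ x ∈ affineSpan ℝ (dom f), x - e ∈ M := fun x hx =>
    AffineSubspace.vsub_mem_direction hx (subset_affineSpan ℝ _ he)
  refine ⟨ψ, c - ψ e, fun p hp => ?_, fun q hq hqL => ?_⟩
  · have := hC (⟨p.1 - e, hM _ (subset_affineSpan ℝ _ (fst_mem_dom_of_mem_epi hp))⟩, p.2)
      (by simpa using hp)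
    rw [← hψ] at this
    simp only [map_sub] at this
    linarith
  · have := hSφ (⟨q.1 - e, hM _ hqL⟩, q.2) (by simpa using hq)
    rw [← hψ] at this
    simp only [map_sub] at this
    linarith

end Sandwich

section BrondstedRockafellar

variable {E F : Type*} [AddCommGroup E] [Module ℝ E] [AddCommGroup F] [Module ℝ F]
  {B : E →ₗ[ℝ] F →ₗ[ℝ] ℝ} {f : E → EReal} {K : Set E}

/-- The cone `{(x, t) | t ≥ 0, x ∈ t K}` over a convex set `K`: it plays the role of the epigraph
of the gauge of `K`, but records which multiple of `K` a point is taken from. -/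
def gaugeCone (hK : Convex ℝ K) : ConvexCone ℝ (E × ℝ) where
  carrier := {p | 0 ≤ p.2 ∧ p.1 ∈ p.2 • K}
  smul_mem' := by
    rintro c hc ⟨x, t⟩ ⟨ht, hx⟩
    exact ⟨mul_nonneg hc.le ht, by simpa [mul_smul] using Set.smul_mem_smul_set hx⟩
  add_mem' := by
    rintro ⟨x, t⟩ ⟨ht, hx⟩ ⟨y, s⟩ ⟨hs, hy⟩
    refine ⟨add_nonneg ht hs, ?_⟩
    rw [Prod.snd_add, hK.add_smul ht hs]
    exact Set.add_mem_add hx hy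

theorem exists_min_on_Icc_smul (hf : ∀ x, f x ≠ ⊥)
    (hlsc : @LowerSemicontinuous _ _ (weakTopology B) _ f) {e : E} (he : e ∈ dom f) (g : F)
    (δ : ℝ) {T : ℝ} (hT : 0 ≤ T) (hK : @IsCompact E (weakTopology B) K) (hK0 : K.Nonempty) :
    ∃ t ∈ Set.Icc 0 T, ∃ k ∈ K, e + t • k ∈ dom f ∧
      ∀ t' ∈ Set.Icc 0 T, ∀ k' ∈ K, ∀ s : ℝ, (e + t' • k', s) ∈ epi f →
        (f (e + t • k)).toReal - B (t • k) g + δ * t ≤ s - B (t' • k') g + δ * t' := by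
  let := weakTopology B
  have := weak_isTopologicalAddGroup (B := B)
  have := weak_continuousSMul (B := B)
  have hcB : Continuous fun x => B x g := weak_continuous_apply g
  let h : ℝ × E → EReal := fun p =>
    f (e + p.1 • p.2) + ((δ * p.1 - B (p.1 • p.2) g : ℝ) : EReal)
  have hle : ∀ (t : ℝ) (k : E) (s : ℝ), (e + t • k, s) ∈ epi f →
      h (t, k) ≤ ((s - B (t • k) g + δ * t : ℝ) : EReal) := fun t k s hs => by
    rw [sub_add_eq_add_sub, add_sub_assoc, EReal.coe_add]
    exact add_le_add_left hs _
  have hlsch : LowerSemicontinuous h :=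
    LowerSemicontinuous.add' (hlsc.comp (by fun_prop))
      (continuous_coe_real_ereal.comp (by fun_prop)).lowerSemicontinuous fun p =>
      EReal.continuousAt_add (Or.inr (EReal.coe_ne_bot _)) (Or.inr (EReal.coe_ne_top _))
  obtain ⟨k₀, hk₀⟩ := hK0
  obtain ⟨⟨t, k⟩, ⟨ht, hk⟩, hmin⟩ := LowerSemicontinuousOn.exists_isMinOn
    (s := Set.Icc 0 T ×ˢ K) ⟨(0, k₀), ⟨le_rfl, hT⟩, hk₀⟩ (isCompact_Icc.prod hK)
    (hlsch.lowerSemicontinuousOn _)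
  have hlt : h (t, k) < ⊤ := by
    refine (hmin (show (0, k₀) ∈ _ from ⟨⟨le_rfl, hT⟩, hk₀⟩)).trans_lt ?_
    refine (hle 0 k₀ (f e).toReal ?_).trans_lt (EReal.coe_lt_top _)
    simpa using mk_toReal_mem_epi he
  have hdom : e + t • k ∈ dom f := by
    by_contra hdom
    have htop : f (e + t • k) = ⊤ := not_lt_top_iff.1 hdom
    exact hlt.ne (by simp only [h, htop, EReal.top_add_coe])
  refine ⟨t, ht, k, hk, hdom, fun t' ht' k' hk' s hs => EReal.coe_le_coe_iff.1 ?_⟩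
  refine le_trans (le_of_eq ?_) ((hmin (show (t', k') ∈ _ from ⟨ht', hk'⟩)).trans (hle t' k' s hs))
  rw [sub_add_eq_add_sub, add_sub_assoc, EReal.coe_add, EReal.coe_toReal hdom.ne (hf _)]

theorem exists_min_add_gauge (hf : ∀ x, f x ≠ ⊥)
    (hlsc : @LowerSemicontinuous _ _ (weakTopology B) _ f) {ε : ℝ} {e : E} {g : F}
    (hg : g ∈ approxSubdiff B f ε e) {δ : ℝ} (hδ : 0 < δ) (hK : K ∈ weakDiscs B)
    (hK0 : K.Nonempty) :
    ∃ q ∈ gaugeCone hK.1, q.2 ≤ ε / δ ∧ e + q.1 ∈ dom f ∧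
      ∀ p ∈ gaugeCone hK.1, ∀ s : ℝ, (e + p.1, s) ∈ epi f →
        (f (e + q.1)).toReal - B q.1 g + δ * q.2 ≤ s - B p.1 g + δ * p.2 := by
  have hT : 0 ≤ ε / δ := div_nonneg (nonneg_of_mem_approxSubdiff hg) hδ.le
  obtain ⟨t, ht, k, hk, hdom, hmin⟩ :=
    exists_min_on_Icc_smul hf hlsc hg.1 g δ hT hK.2.2 hK0
  refine ⟨(t • k, t), ⟨ht.1, Set.smul_mem_smul_set hk⟩, ht.2, hdom, ?_⟩
  rintro ⟨u, t'⟩ ⟨ht', k', hk', hu⟩ s hs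
  obtain rfl : t' • k' = u := hu
  rcases le_or_gt t' (ε / δ) with hle | hgt
  · exact hmin t' ⟨ht', hle⟩ k' hk' s hs
  · have hmin₀ := hmin 0 ⟨le_rfl, hT⟩ k hk (f e).toReal (by simpa using mk_toReal_mem_epi hg.1)
    have hsub := hg.2 _ hs
    rw [div_lt_iff₀ hδ] at hgt
    simp only [zero_smul, map_zero, LinearMap.zero_apply] at hmin₀
    rw [add_sub_cancel_left] at hsub
    dsimp only at hsub ⊢
    linarith

variable [TopologicalSpace E] [IsTopologicalAddGroup E] [ContinuousSMul ℝ E]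
  [LocallyConvexSpace ℝ E] [TopologicalSpace F]

theorem exists_sandwich_at_min (hB : IsDualPair B) (hconv : Convex ℝ (epi f))
    {e₁ : E} (he₁ : e₁ ∈ dom f) (hcont : ContinuousWithinAt f (affineSpan ℝ (dom f)) e₁)
    {e : E} {g : F} {δ c : ℝ} (hK : Convex ℝ K)
    (hmin : ∀ p ∈ gaugeCone hK, ∀ s : ℝ, (e + p.1, s) ∈ epi f → c ≤ s - B p.1 g + δ * p.2)
    {σ : ℝ} (hσ : 0 < σ) (hσK : σ • (e₁ - e) ∈ K) :
    ∃ (g₁ : F) (a : ℝ), (∀ p ∈ epi f, B p.1 g₁ + a ≤ p.2) ∧ ∀ p ∈ gaugeCone hK,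
      e + p.1 ∈ affineSpan ℝ (dom f) → c + (B p.1 g - δ * p.2) ≤ B (e + p.1) g₁ + a := by
  let Λ : E × ℝ →ₗ[ℝ] E × ℝ := (LinearMap.fst ℝ E ℝ).prod
    (B.flip g ∘ₗ LinearMap.fst ℝ E ℝ - δ • LinearMap.snd ℝ E ℝ)
  have hΛ : ∀ p, (e, c) + Λ p = (e + p.1, c + (B p.1 g - δ * p.2)) := fun p => rfl
  have hS : Convex ℝ ((fun w => (e, c) + w) '' (Λ '' gaugeCone hK)) :=
    ((gaugeCone hK).convex.linear_image Λ).translate (e, c)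
  have hmemS : ∀ p ∈ gaugeCone hK, (e + p.1, c + (B p.1 g - δ * p.2)) ∈
      (fun w => (e, c) + w) '' (Λ '' gaugeCone hK) := fun p hp =>
    ⟨Λ p, ⟨p, hp, rfl⟩, hΛ p⟩
  have he₁K : (e₁ - e, σ⁻¹) ∈ gaugeCone hK :=
    ⟨inv_nonneg.2 hσ.le, by simpa [hσ.ne'] using Set.smul_mem_smul_set (a := σ⁻¹) hσK⟩
  obtain ⟨φ, a, hφf, hφS⟩ := exists_sandwich_of_continuousWithinAt hconv he₁ hcont hS
    (r₀ := c + (B (e₁ - e) g - δ * σ⁻¹)) (by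
      rintro x s r hs ⟨_, ⟨p, hp, rfl⟩, hpx⟩
      obtain ⟨rfl, rfl⟩ := Prod.mk.inj ((hΛ p).symm.trans hpx)
      linarith [hmin p hp s hs]) (by simpa using hmemS _ he₁K)
  obtain ⟨g₁, hg₁⟩ := hB.exists_right φ
  simp only [hg₁] at hφf hφS
  exact ⟨g₁, a, hφf, fun p hp hpL => hφS _ (hmemS p hp) hpL⟩

theorem exists_approxSubdiff_zero_at_min (hB : IsDualPair B) (hconv : Convex ℝ (epi f))
    {e₁ : E} (he₁ : e₁ ∈ dom f) (hcont : ContinuousWithinAt f (affineSpan ℝ (dom f)) e₁)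
    {e : E} {g : F} {δ : ℝ} (hK : Convex ℝ K) (hKb : Balanced ℝ K) {q : E × ℝ}
    (hq : q ∈ gaugeCone hK) (hdom : e + q.1 ∈ dom f)
    (hmin : ∀ p ∈ gaugeCone hK, ∀ s : ℝ, (e + p.1, s) ∈ epi f →
      (f (e + q.1)).toReal - B q.1 g + δ * q.2 ≤ s - B p.1 g + δ * p.2)
    {σ : ℝ} (hσ : 0 < σ) (hσK : σ • (e₁ - e) ∈ K) :
    ∃ g₁ ∈ approxSubdiff B f 0 (e + q.1),
      ∀ k ∈ K, k ∈ (affineSpan ℝ (dom f)).direction → |B k (g₁ - g)| ≤ δ := by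
  obtain ⟨g₁, a, hminor, hmajor⟩ := exists_sandwich_at_min hB hconv he₁ hcont hK hmin hσ hσK
  have hqL : e + q.1 ∈ affineSpan ℝ (dom f) := subset_affineSpan ℝ _ hdom
  have htouch : (f (e + q.1)).toReal ≤ B (e + q.1) g₁ + a := by linarith [hmajor q hq hqL]
  have hslope : ∀ k ∈ K, k ∈ (affineSpan ℝ (dom f)).direction → -δ ≤ B k (g₁ - g) := by
    intro k hk hkM
    have hqk := (gaugeCone hK).add_mem hq (y := (k, 1)) ⟨zero_le_one, by simpa using hk⟩
    have hupper := hmajor _ hqk (by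
      simpa [add_comm, add_left_comm] using AffineSubspace.vadd_mem_of_mem_direction hkM hqL)
    have hlower := hminor _ (mk_toReal_mem_epi hdom)
    simp only [Prod.fst_add, Prod.snd_add, map_add, map_sub, LinearMap.add_apply] at hupper hlower ⊢
    linarith
  refine ⟨g₁, ⟨hdom, fun p hp => ?_⟩, fun k hk hkM => abs_le.2 ⟨hslope k hk hkM, ?_⟩⟩
  · rw [map_sub, LinearMap.sub_apply]
    linarith [hminor p hp]
  · have := hslope (-k) (hKb.neg_mem_iff.2 hk) (neg_mem hkM)
    rw [map_neg, LinearMap.neg_apply] at this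
    linarith

variable [IsTopologicalAddGroup F] [ContinuousSMul ℝ F] [LocallyConvexSpace ℝ F]

theorem exists_annihilator_sub_mem (hB : IsDualPair B) {M : Submodule ℝ E}
    (hM : IsClosed (M : Set E)) (hK : K ∈ weakDiscs B) (hK0 : K.Nonempty) {δ : ℝ} (hδ : 0 < δ)
    {z : F} (hz : ∀ k ∈ K, k ∈ M → |B k z| ≤ δ) {N : Set F} (hN : N ∈ 𝓝 0) :
    ∃ m, (∀ x ∈ M, B x m = 0) ∧ z - m ∈ δ • B.polar K + N := by
  have hMac : AbsConvex ℝ (M : Set E) := ⟨fun a _ _ ⟨x, hx, hxy⟩ => hxy ▸ M.smul_mem a hx, M.convex⟩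
  have hmem : δ⁻¹ • z ∈ closure (B.polar K + B.polar (M : Set E)) := by
    refine polar_inter_subset_closure (fun _ => hB.exists_right _) (fun _ => hB.flip.exists_right _)
      ⟨hK.2.1, hK.1⟩ (hB.isClosed_of_mem_weakDiscs hK) hK0 hMac hM ⟨0, M.zero_mem⟩ ?_
    rintro k ⟨hkK, hkM⟩
    rw [map_smul, smul_eq_mul, Real.norm_eq_abs, abs_mul, abs_of_pos (inv_pos.2 hδ),
      inv_mul_le_one₀ hδ]
    exact hz k hkK hkM
  have hcont : Continuous fun w : F => z - δ • w := by fun_prop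
  have hnear : ∀ᶠ w in 𝓝 (δ⁻¹ • z), z - δ • w ∈ N :=
    hcont.continuousAt.eventually (by simpa [hδ.ne'] using hN)
  obtain ⟨_, hwN, κ, hκ, m, hm, rfl⟩ := mem_closure_iff_nhds.1 hmem _ hnear
  rw [LinearMap.polar_subMulAction] at hm
  refine ⟨δ • m, fun x hx => by simp [hm x hx], δ • κ, Set.smul_mem_smul_set hκ, _, hwN, ?_⟩
  simp only [smul_add]
  abel

/-- A Brøndsted–Rockafellar theorem: minimizing `f - g + δ · gauge K` around `e` yields `z`, and the
sum rule for subgradients, available up to closure, yields `h`. -/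
theorem exists_subdiff_near (hB : IsDualPair B) (hf : ∀ x, f x ≠ ⊥) (hconv : Convex ℝ (epi f))
    (hlsc : @LowerSemicontinuous _ _ (weakTopology B) _ f)
    (hL : IsClosed (affineSpan ℝ (dom f) : Set E)) {e₁ : E} (he₁ : e₁ ∈ dom f)
    (hcont : ContinuousWithinAt f (affineSpan ℝ (dom f)) e₁) {ε : ℝ} {e : E} {g : F}
    (hg : g ∈ approxSubdiff B f ε e) {δ : ℝ} (hδ : 0 < δ) (hK : K ∈ weakDiscs B) {σ : ℝ}
    (hσ : 0 < σ) (hσK : σ • (e₁ - e) ∈ K) :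
    ∃ t z, 0 ≤ t ∧ t ≤ ε / δ ∧ z ∈ t • K ∧ ∀ N ∈ 𝓝 (0 : F), ∃ h ∈ δ • B.polar K + N,
      g + h ∈ subdiff B f (e + z) := by
  obtain ⟨q, hq, hqT, hdom, hmin⟩ := exists_min_add_gauge hf hlsc hg hδ hK ⟨_, hσK⟩
  obtain ⟨g₁, hg₁, hslope⟩ := exists_approxSubdiff_zero_at_min hB hconv he₁ hcont hK.1 hK.2.1 hq
    hdom hmin hσ hσK
  refine ⟨q.2, q.1, hq.1, hqT, hq.2, fun N hN => ?_⟩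
  have hdomL := subset_affineSpan ℝ (dom f)
  have hM : IsClosed ((affineSpan ℝ (dom f)).direction : Set E) := by
    have hpre := hL.preimage (f := fun v : E => v + (e + q.1)) (by fun_prop)
    convert hpre using 1
    exact Set.ext fun v => (AffineSubspace.vadd_mem_iff_mem_direction v (hdomL hdom)).symm
  obtain ⟨m, hm, hmN⟩ := exists_annihilator_sub_mem hB hM hK ⟨_, hσK⟩ hδ hslope hN
  refine ⟨g₁ - g - m, hmN, ?_⟩
  rw [← approxSubdiff_zero hf]
  refine ⟨hdom, fun p hp => ?_⟩
  have hpM := AffineSubspace.vsub_mem_direction (hdomL (fst_mem_dom_of_mem_epi hp)) (hdomL hdom)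
  rw [add_sub_assoc', add_sub_cancel, map_sub, ← vsub_eq_sub p.1, hm _ hpM, sub_zero]
  exact hg₁.2 p hp

end BrondstedRockafellar

section ExactApproximation

variable {X Y : Type*} [AddCommGroup X] [Module ℝ X] [AddCommGroup Y] [Module ℝ Y]
  {B : X →ₗ[ℝ] Y →ₗ[ℝ] ℝ} {f : X → EReal} {x₀ : X} {v : Y}

theorem abs_apply_le_of_mem_smul {K : Set X} {t : ℝ} (ht : 0 ≤ t) {z : X} (hz : z ∈ t • K) {y : Y}
    (hy : y ∈ B.polar K) : |B z y| ≤ t := by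
  obtain ⟨k, hk, rfl⟩ := hz
  simp only [map_smul, LinearMap.smul_apply, smul_eq_mul, abs_mul, abs_of_nonneg ht]
  exact mul_le_of_le_one_right ht (hy k hk)

theorem abs_apply_smul_add_lt {x₁ x₂ : X} {w : Y} {δ c r : ℝ} (hδ : 0 < δ) (h₁ : |B x₁ w| ≤ c)
    (h₂ : |B x₂ w| < r) : |B (δ • x₁ + x₂) w| < δ * c + r := by
  rw [map_add, map_smul, LinearMap.add_apply, LinearMap.smul_apply, smul_eq_mul]
  refine (abs_add_le _ _).trans_lt (add_lt_add_of_le_of_lt ?_ h₂)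
  rw [abs_mul, abs_of_pos hδ]
  exact mul_le_mul_of_nonneg_left h₁ hδ.le

/-- The pointwise form of the regularity condition `FiniteContinuousOnRelInterior`: the affine hull
of `dom f` is closed, and the restriction of `f` to it is continuous at some point of `dom f`. -/
def HasRelContinuityPoint {E : Type*} [AddCommGroup E] [Module ℝ E] (t : TopologicalSpace E)
    (f : E → EReal) : Prop :=
  IsClosed[t] (affineSpan ℝ (dom f) : Set E) ∧
    ∃ e ∈ dom f, ContinuousWithinAt f (affineSpan ℝ (dom f)) e

theorem FiniteContinuousOnRelInterior.hasRelContinuityPoint {E : Type*} [AddCommGroup E]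
    [Module ℝ E] {t : TopologicalSpace E} {f : E → EReal}
    (h : FiniteContinuousOnRelInterior t f) : HasRelContinuityPoint t f := by
  obtain ⟨⟨e, he⟩, hcont⟩ := h
  have hce := (hcont e he).2.2
  unfold relInterior at he
  split_ifs at he with hcl
  · exact ⟨hcl, e, intrinsicInterior_subset he, hce⟩
  · exact he.elim

variable [TopologicalSpace Y]

theorem tendsto_smul_approxFilter :
    Tendsto (fun p => p.1 • p.2.2) (approxFilter B f x₀ v) (𝓝 v) :=
  (continuous_fst.tendsto _).comp (tendsto_inf_left tendsto_comap)

theorem tendsto_mul_approxFilter :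
    Tendsto (fun p => p.1 * p.2.1) (approxFilter B f x₀ v) (𝓝 0) :=
  (continuous_snd.tendsto _).comp (tendsto_inf_left tendsto_comap)

theorem eventually_approxFilter :
    ∀ᶠ p in approxFilter B f x₀ v, 0 < p.1 ∧ p.2.2 ∈ approxSubdiff B f p.2.1 x₀ :=
  mem_inf_of_right (mem_principal_self _)

theorem tendsto_smul_sub_approxFilter [IsTopologicalAddGroup Y] :
    Tendsto (fun p => p.1 • p.2.2 - v) (approxFilter B f x₀ v) (𝓝 0) :=
  sub_self v ▸ tendsto_smul_approxFilter.sub_const v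

variable [TopologicalSpace X] [IsTopologicalAddGroup X] [ContinuousSMul ℝ X]
  [LocallyConvexSpace ℝ X]

theorem smul_sub_mem_add_segment {E : Type*} [AddCommGroup E] [Module ℝ E] {K : Set E}
    (hK : AbsConvex ℝ K) {v y₁ : E} (hv : v ∈ K) (hy₁ : y₁ ∈ K) {μ : ℝ} (hμ : 0 < μ) (y : E) :
    (μ / (1 + μ)) • (y₁ - y) ∈ K + (fun τ : ℝ => τ • (μ • y - v)) '' Set.Icc (-1) 1 := by
  have hμ1 : 0 < 1 + μ := by linarith
  have hinv : (1 + μ)⁻¹ ≤ 1 := inv_le_one_of_one_le₀ (by linarith)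
  refine ⟨(μ / (1 + μ)) • y₁ + (1 + μ)⁻¹ • -v, hK.2 hy₁ (hK.1.neg_mem_iff.2 hv) (by positivity)
    (by positivity) (by field_simp; ring), _, ⟨-(1 + μ)⁻¹, ⟨by linarith, ?_⟩, rfl⟩, ?_⟩
  · linarith [inv_pos.2 hμ1]
  · simp only [div_eq_mul_inv]
    module

theorem exists_perturbation_of_continuousWithinAt_conj (hB : IsDualPair B) (hf : IsGammaZero f)
    (hL : IsClosed[mackeyTopology B] (affineSpan ℝ (dom (conj B f)) : Set Y)) {y₁ : Y}
    (hy₁ : y₁ ∈ dom (conj B f))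
    (hcont : @ContinuousWithinAt _ _ (mackeyTopology B) _ (conj B f)
      (affineSpan ℝ (dom (conj B f))) y₁)
    {μ ε δ : ℝ} {y : Y} (hμ : 0 < μ) (hδ : 0 < δ) (hy : y ∈ approxSubdiff B f ε x₀) {V : Set X}
    (hV : V ∈ 𝓝 0) (hVa : AbsConvex ℝ V) (hVc : IsClosed V) (hvV : v ∈ B.polar V)
    (hy₁V : y₁ ∈ B.polar V) {r : ℝ} (hr : 0 < r) :
    ∃ z ∈ δ • V + V, ∃ w ∈ (μ * ε / δ) • (B.polar V +
        (fun τ : ℝ => τ • (μ • y - v)) '' Set.Icc (-1) 1),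
      y + μ⁻¹ • w ∈ subdiff B f (x₀ + z) ∧ |B z (μ • y - v)| < δ + r ∧ |B z w| < μ * ε + r := by
  have hK₀ := polar_mem_weakDiscs (B := B.flip) (fun _ => hB.exists_right _) hV
  have hK := add_mem_weakDiscs hK₀ (segment_mem_weakDiscs B.flip (μ • y - v))
  obtain ⟨t, u, ht, htε, hu, hN⟩ := @exists_subdiff_near Y X _ _ _ _ B.flip (conj B f) _
    (mackeyTopology B) (mackey_isTopologicalAddGroup B) (mackey_continuousSMul B)
    (mackey_locallyConvexSpace B) _ _ _ _ hB.mackey_flip (conj_ne_bot hf.dom_nonempty)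
    (convex_epi_conj B f) (lowerSemicontinuous_conj B f) hL _ hy₁ hcont _ _ _
    ((mem_approxSubdiff_conj_iff hB hf).2 hy) _ hδ hK _ (by positivity)
    (smul_sub_mem_add_segment ⟨hK₀.2.1, hK₀.1⟩ hvV hy₁V hμ y)
  have hμt : μ * t ≤ μ * ε / δ := by
    rw [mul_div_assoc]
    exact mul_le_mul_of_nonneg_left htε hμ.le
  have hμu : μ • u ∈ (μ * t) • (B.polar V + (fun τ : ℝ => τ • (μ • y - v)) '' Set.Icc (-1) 1) := by
    rw [mul_smul]
    exact Set.smul_mem_smul_set hu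
  obtain ⟨_, ⟨_, ⟨κ, hκ, rfl⟩, n, ⟨⟨hnV, hnq⟩, hnu⟩, rfl⟩, hsub⟩ := hN _
    (inter_mem (inter_mem hV (hB.flip.setOf_abs_lt_mem_nhds (μ • y - v) hr))
      (hB.flip.setOf_abs_lt_mem_nhds (μ • u) hr))
  have h0 : (0 : Y) ∈ (fun τ : ℝ => τ • (μ • y - v)) '' Set.Icc (-1) 1 :=
    ⟨0, by simp, zero_smul _ _⟩
  have hκV : κ ∈ V := by
    rw [← bipolar_eq (fun _ => hB.exists_right _) hVa hVc ⟨0, mem_of_mem_nhds hV⟩]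
    exact B.flip.polar_antitone (Set.subset_add_left _ h0) hκ
  have hκq : |B κ (μ • y - v)| ≤ 1 :=
    hκ _ ⟨0, B.zero_mem_polar V, _, ⟨1, by simp, one_smul _ _⟩, zero_add _⟩
  have hκu : |B κ (μ • u)| ≤ μ * t := by
    rw [map_smul, smul_eq_mul, abs_mul, abs_of_pos hμ]
    exact mul_le_mul_of_nonneg_left (abs_apply_le_of_mem_smul ht hu hκ) hμ.le
  refine ⟨δ • κ + n, Set.add_mem_add (Set.smul_mem_smul_set hκV) hnV, μ • u,
    hK.2.1.smul_mono (abs_le_abs_of_nonneg (by positivity) hμt) hμu, ?_, ?_, ?_⟩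
  · rw [inv_smul_smul₀ hμ.ne']
    exact mem_subdiff_of_mem_subdiff_conj hB hf hsub
  · simpa using abs_apply_smul_add_lt hδ hκq hnq
  · refine (abs_apply_smul_add_lt hδ hκu hnu).trans_le (add_le_add_left ?_ r)
    rwa [le_div_iff₀ hδ, mul_comm] at hμt

variable [IsTopologicalAddGroup Y] [ContinuousSMul ℝ Y] [LocallyConvexSpace ℝ Y]

theorem exists_perturbation_of_continuousWithinAt (hB : IsDualPair B) (hf : IsGammaZero f)
    (hL : IsClosed (affineSpan ℝ (dom f) : Set X)) {x₁ : X} (hx₁ : x₁ ∈ dom f)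
    (hcont : ContinuousWithinAt f (affineSpan ℝ (dom f)) x₁) {μ ε : ℝ} {y : Y} (hμ : 0 < μ)
    (hy : y ∈ approxSubdiff B f ε x₀) {V : Set Y} (hV : V ∈ 𝓝 0) (hVa : AbsConvex ℝ V)
    (hVc : IsClosed V) (hx₁V : x₁ - x₀ ∈ B.flip.polar V) {r : ℝ} (hr : 0 < r) :
    ∃ z ∈ (μ * ε) • B.flip.polar V, ∃ w ∈ V + V,
      y + μ⁻¹ • w ∈ subdiff B f (x₀ + z) ∧ |B z w| < μ * ε + r := by
  have hK := polar_mem_weakDiscs (fun _ => hB.flip.exists_right _) hV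
  obtain ⟨t, z, ht, htε, hz, hN⟩ := exists_subdiff_near hB hf.ne_bot hf.convex_epi
    (lowerSemicontinuous_weak hB hf) hL hx₁ hcont hy (inv_pos.2 hμ) hK one_pos
    (by rwa [one_smul])
  rw [div_inv_eq_mul, mul_comm] at htε
  have hNV : (fun n : Y => μ • n) ⁻¹' (V ∩ {n | |B z n| < r}) ∈ 𝓝 0 :=
    (continuous_const_smul μ).continuousAt.preimage_mem_nhds
      (by simpa using ⟨hV, hB.setOf_abs_lt_mem_nhds z hr⟩)
  obtain ⟨_, ⟨_, ⟨κ, hκ, rfl⟩, n, ⟨hnV, hnr⟩, rfl⟩, hsub⟩ := hN _ hNV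
  have hκV : κ ∈ V := by
    rwa [← bipolar_eq (B := B.flip) (fun _ => hB.flip.exists_right _) hVa hVc
      ⟨0, mem_of_mem_nhds hV⟩]
  refine ⟨z, hK.2.1.smul_mono (abs_le_abs_of_nonneg ht htε) hz, κ + μ • n,
    Set.add_mem_add hκV hnV, by rwa [smul_add, inv_smul_smul₀ hμ.ne'], ?_⟩
  rw [map_add]
  exact (abs_add_le _ _).trans_lt
    (add_lt_add_of_le_of_lt ((abs_apply_le_of_mem_smul ht hz hκ).trans htε) hnr)

/-- Approximate subgradients `y` of `f` at `x₀` with `μ y → v` and `μ ε → 0` can be perturbed to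
exact subgradients `y + μ⁻¹ w` at points `x₀ + z` with `z` and `w` small. -/
def HasExactApproximations (B : X →ₗ[ℝ] Y →ₗ[ℝ] ℝ) (f : X → EReal) (x₀ : X) : Prop :=
  ∀ v : Y, ∀ U ∈ 𝓝 (0 : X), ∀ W ∈ 𝓝 (0 : Y), ∀ ρ > 0, ∀ᶠ p in approxFilter B f x₀ v,
    ∃ z ∈ U, ∃ w ∈ W, p.2.2 + p.1⁻¹ • w ∈ subdiff B f (x₀ + z) ∧
      |B z (p.1 • p.2.2 - v)| < ρ ∧ |B z w| < ρ

theorem HasRelContinuityPoint.hasExactApproximations (hB : IsDualPair B) (hf : IsGammaZero f)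
    (hcont : HasRelContinuityPoint inferInstance f) (x₀ : X) : HasExactApproximations B f x₀ := by
  obtain ⟨hL, x₁, hx₁, hx₁cont⟩ := hcont
  intro v U hU W hW ρ hρ
  obtain ⟨V, hV, hVa, hVc, hVW⟩ := exists_absConvex_isClosed_nhds_add_subset
    (inter_mem hW (hB.setOf_abs_lt_mem_nhds (x₁ - x₀) one_pos))
  have hx₁V : x₁ - x₀ ∈ B.flip.polar V := fun w hw =>
    (hVW (Set.subset_add_left V (mem_of_mem_nhds hV) hw)).2.le
  have hK := polar_mem_weakDiscs (B := B) (fun _ => hB.flip.exists_right _) hV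
  filter_upwards [eventually_approxFilter, tendsto_smul_sub_approxFilter hV,
    tendsto_mul_approxFilter.eventually_lt_const (half_pos hρ),
    eventually_smul_subset (hB.isVonNBounded_of_mem_weakDiscs hK) hU tendsto_mul_approxFilter]
    with ⟨μ, ε, y⟩ ⟨hμ, hy⟩ hq hμε hμεU
  obtain ⟨z, hz, w, hw, hsub, hzw⟩ := exists_perturbation_of_continuousWithinAt hB hf hL hx₁
    hx₁cont hμ hy hV hVa hVc hx₁V (half_pos hρ)
  have hzq : |B z (μ • y - v)| ≤ μ * ε :=
    abs_apply_le_of_mem_smul (mul_nonneg hμ.le (nonneg_of_mem_approxSubdiff hy)) hz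
      (B.flip.subset_bipolar V hq)
  dsimp only at hμε hzw ⊢
  exact ⟨z, hμεU hz, w, (hVW hw).1, hsub, hzq.trans_lt (by linarith), by linarith⟩

theorem HasRelContinuityPoint.hasExactApproximations_of_conj (hB : IsDualPair B)
    (hf : IsGammaZero f) (hcont : HasRelContinuityPoint (mackeyTopology B) (conj B f)) (x₀ : X) :
    HasExactApproximations B f x₀ := by
  obtain ⟨hL, y₁, hy₁, hy₁cont⟩ := hcont
  intro v U hU W hW ρ hρ
  obtain ⟨V, hV, hVa, hVc, hVU⟩ := exists_absConvex_isClosed_nhds_add_subset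
    (inter_mem hU (inter_mem (hB.flip.setOf_abs_lt_mem_nhds v one_pos)
      (hB.flip.setOf_abs_lt_mem_nhds y₁ one_pos)))
  have hVU' := (Set.subset_add_left V (mem_of_mem_nhds hV)).trans hVU
  obtain ⟨W₁, hW₁, hW₁a, -, hW₁W⟩ := exists_absConvex_isClosed_nhds_add_subset hW
  have hK₀ := polar_mem_weakDiscs (B := B.flip) (fun _ => hB.exists_right _) hV
  let δ := min 1 (ρ / 2)
  have hδ : 0 < δ := by positivity
  have htend : Tendsto (fun p : ℝ × ℝ × Y => p.1 * p.2.1 / δ) (approxFilter B f x₀ v) (𝓝 0) :=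
    zero_div δ ▸ tendsto_mul_approxFilter.div_const δ
  filter_upwards [eventually_approxFilter, tendsto_smul_sub_approxFilter hW₁,
    tendsto_mul_approxFilter.eventually_lt_const (half_pos hρ),
    htend.eventually_lt_const one_pos,
    eventually_smul_subset (hB.flip.isVonNBounded_of_mem_weakDiscs hK₀) hW₁ htend]
    with ⟨μ, ε, y⟩ ⟨hμ, hy⟩ hq hμε hμε₁ hμεW
  dsimp only at hμ hy hq hμε hμε₁ hμεW ⊢
  obtain ⟨z, hz, w, hw, hsub, hzq, hzw⟩ := exists_perturbation_of_continuousWithinAt_conj hB hf hL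
    hy₁ hy₁cont hμ hδ hy hV hVa hVc (fun x hx => (hVU' hx).2.1.le) (fun x hx => (hVU' hx).2.2.le)
    (half_pos hρ)
  have hδV : δ • V ⊆ V := hVa.1 δ (by simp [abs_of_pos hδ, δ])
  have hδρ : δ ≤ ρ / 2 := min_le_right _ _
  refine ⟨z, (hVU (Set.add_subset_add_right hδV hz)).1, w, hW₁W ?_, hsub, by linarith, by linarith⟩
  obtain ⟨_, ⟨k, hk, _, ⟨τ, hτ, rfl⟩, rfl⟩, rfl⟩ := hw
  have hμε₀ : 0 ≤ μ * ε / δ :=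
    div_nonneg (mul_nonneg hμ.le (nonneg_of_mem_approxSubdiff hy)) hδ.le
  have hτ₁ : ‖μ * ε / δ * τ‖ ≤ 1 := by
    rw [norm_mul, Real.norm_of_nonneg hμε₀]
    exact mul_le_one₀ hμε₁.le (norm_nonneg τ) (abs_le.2 hτ)
  dsimp only
  rw [smul_add, smul_smul]
  exact Set.add_mem_add (hμεW (Set.smul_mem_smul_set hk)) (hW₁a.1.smul_mem hτ₁ hq)

end ExactApproximation

section UpperLimit

theorem upperLimit_mono {U V : Type*} [TopologicalSpace V] {F G : Filter U} (h : F ≤ G)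
    (M : U → Set V) : upperLimit F M ⊆ upperLimit G M :=
  fun _ hv W hW Z hZ => hv W hW Z (h hZ)

variable {X Y : Type*} [AddCommGroup X] [Module ℝ X] [AddCommGroup Y] [Module ℝ Y]
  {B : X →ₗ[ℝ] Y →ₗ[ℝ] ℝ} {f : X → EReal} {x₀ : X} {v : Y}

theorem hasBasis_valueFilter (B : X →ₗ[ℝ] Y →ₗ[ℝ] ℝ) (f : X → EReal) (x₀ : X) :
    (valueFilter B f x₀).HasBasis (0 < ·) fun r => {p | 0 ≤ p.2.1 ∧
      |p.2.1 * ((f p.1).toReal - (f x₀).toReal)| < r ∧ |p.2.1 * B (p.1 - x₀) p.2.2| < r} := by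
  have hbasis := ((Metric.nhds_basis_ball (x := (0 : ℝ))).prod_self.comap fun p : X × ℝ × Y =>
    (p.2.1 * ((f p.1).toReal - (f x₀).toReal), p.2.1 * B (p.1 - x₀) p.2.2)).principal_inf
      {p | 0 ≤ p.2.1}
  rw [comap_prod, ← inf_assoc] at hbasis
  refine hbasis.congr (fun _ => Iff.rfl) fun r _ => ?_
  ext p
  simp

theorem toReal_sub_toReal_mem_Icc {x x' : X} {y y' : Y} {ε ε' : ℝ}
    (hy : y ∈ approxSubdiff B f ε x) (hy' : y' ∈ approxSubdiff B f ε' x') :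
    (f x').toReal - (f x).toReal ∈ Set.Icc (B (x' - x) y - ε) (B (x' - x) y' + ε') := by
  have h := hy.2 _ (mk_toReal_mem_epi hy'.1)
  have h' := hy'.2 _ (mk_toReal_mem_epi hy.1)
  simp only [map_sub, LinearMap.sub_apply] at h h' ⊢
  constructor <;> linarith

theorem abs_mul_lt_of_perturbation (hbot : ∀ x, f x ≠ ⊥) {μ ε r : ℝ} {y w : Y} {z : X}
    (hμ : 0 < μ) (hy : y ∈ approxSubdiff B f ε x₀) (hyw : y + μ⁻¹ • w ∈ subdiff B f (x₀ + z))
    (hε : μ * ε < r) (hv : |B z v| < r) (hq : |B z (μ • y - v)| < r) (hw : |B z w| < r) :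
    |μ * ((f (x₀ + z)).toReal - (f x₀).toReal)| < 3 * r ∧
      |μ * B (x₀ + z - x₀) (y + μ⁻¹ • w)| < 3 * r := by
  rw [← approxSubdiff_zero hbot] at hyw
  have hval := toReal_sub_toReal_mem_Icc hy hyw
  have hlower := mul_le_mul_of_nonneg_left hval.1 hμ.le
  have hupper := mul_le_mul_of_nonneg_left hval.2 hμ.le
  simp only [add_sub_cancel_left, add_zero, mul_sub, mul_add, map_add, map_sub, map_smul,
    smul_eq_mul, mul_inv_cancel_left₀ hμ.ne'] at hlower hupper hq ⊢
  rw [abs_lt] at hv hq hw ⊢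
  rw [abs_lt]
  exact ⟨⟨by linarith, by linarith⟩, by linarith, by linarith⟩

variable [TopologicalSpace X]

theorem comap_fst_nhds_le_quotientFilter (B : X →ₗ[ℝ] Y →ₗ[ℝ] ℝ) (A : Set Y) (x₀ : X) :
    comap Prod.fst (𝓝 x₀) ≤ quotientFilter B A x₀ :=
  (comap_mono (continuous_quot_mk.tendsto x₀).le_comap).trans_eq comap_comap

variable [TopologicalSpace Y]

theorem upperLimit_subset_normalCone (hB : IsDualPair B) (hbot : ∀ x, f x ≠ ⊥)
    (hx₀ : x₀ ∈ dom f) :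
    upperLimit (valueFilter B f x₀) (scaledSubdiff B f) ⊆ normalCone B (sublevel f (f x₀)) x₀ := by
  intro v hv x hx
  by_contra! hpos
  obtain ⟨r, hr, hrv⟩ := exists_between hpos
  obtain ⟨⟨u, μ, y⟩, ⟨hμ, hval, hBu⟩, _, ⟨hy, rfl⟩, hry⟩ := hv _
    ((hB.continuous_right (x - x₀)).continuousAt.eventually_const_lt hrv) _
    ((hasBasis_valueFilter B f x₀).mem_of_mem (half_pos hr))
  rw [← approxSubdiff_zero hbot] at hy
  have hxu := mul_le_mul_of_nonneg_left
    (hy.2 (x, (f x₀).toReal) (le_trans (b := f x₀) hx (mk_toReal_mem_epi hx₀))) hμ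
  dsimp only at hval hBu hxu
  change r < B (x - x₀) (μ • y) at hry
  rw [abs_lt] at hval hBu
  simp only [map_sub, LinearMap.sub_apply, map_smul, smul_eq_mul] at hry hxu hBu
  linarith

theorem normalCone_subset_upperLimit [IsTopologicalAddGroup X] [ContinuousSMul ℝ X]
    [LocallyConvexSpace ℝ X] [IsTopologicalAddGroup Y] [ContinuousSMul ℝ Y]
    [LocallyConvexSpace ℝ Y] (hB : IsDualPair B) (hf : IsGammaZero f) (hx₀ : x₀ ∈ dom f)
    (happ : HasExactApproximations B f x₀) :
    normalCone B (sublevel f (f x₀)) x₀ ⊆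
      upperLimit (valueFilter B f x₀ ⊓ comap Prod.fst (𝓝 x₀)) (scaledSubdiff B f) := by
  intro v hv W hW Z hZ
  obtain ⟨S, hS, T, hT, rfl⟩ := mem_inf_iff.1 hZ
  obtain ⟨U, hU, hUT⟩ := mem_comap.1 hT
  obtain ⟨r, hr, hrS⟩ := (hasBasis_valueFilter B f x₀).mem_iff.1 hS
  have hr₃ : 0 < r / 3 := by positivity
  have hU₀ : {z | x₀ + z ∈ U} ∈ 𝓝 (0 : X) :=
    (continuous_const_add x₀).continuousAt.preimage_mem_nhds (by rwa [add_zero])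
  have hW₀ : {q : Y × Y | v + q.1 + q.2 ∈ W} ∈ 𝓝 (0 : Y × Y) :=
    (by fun_prop : Continuous fun q : Y × Y => v + q.1 + q.2).continuousAt.preimage_mem_nhds
      (by simpa using hW)
  rw [Prod.zero_eq_mk, nhds_prod_eq] at hW₀
  obtain ⟨Q, hQ, P, hP, hQPW⟩ := mem_prod_iff.1 hW₀
  have := approxFilter_neBot hB hf hx₀ hv
  obtain ⟨⟨μ, ε, y⟩, ⟨⟨⟨hμ, hy⟩, hyv⟩, hμε⟩, z, ⟨hzU, hzv⟩, w, hwP, hsub, hzq, hzw⟩ :=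
    (((eventually_approxFilter.and (tendsto_smul_sub_approxFilter hQ)).and
      (tendsto_mul_approxFilter.eventually_lt_const hr₃)).and
      (happ v _ (inter_mem hU₀ (hB.flip.setOf_abs_lt_mem_nhds v hr₃)) P hP _ hr₃)).exists
  dsimp only at hμ hy hμε hsub hzq
  obtain ⟨hval, hBz⟩ := abs_mul_lt_of_perturbation hf.ne_bot hμ hy hsub hμε hzv hzq hzw
  rw [mul_div_cancel₀ r three_ne_zero] at hval hBz
  have hμW : μ • (y + μ⁻¹ • w) ∈ W := by
    have := hQPW (Set.mk_mem_prod hyv hwP)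
    simpa [smul_inv_smul₀ hμ.ne'] using this
  exact ⟨(x₀ + z, μ, y + μ⁻¹ • w), ⟨hrS ⟨hμ.le, hval, hBz⟩, hUT hzU⟩, _, ⟨hsub, rfl⟩, hμW⟩

end UpperLimit

end ConvexDual

end

theorem theorem4p4_general {X Y : Type*}
    [AddCommGroup X] [Module ℝ X] [tX : TopologicalSpace X] [IsTopologicalAddGroup X]
    [ContinuousSMul ℝ X] [LocallyConvexSpace ℝ X]
    [AddCommGroup Y] [Module ℝ Y] [TopologicalSpace Y] [IsTopologicalAddGroup Y]
    [ContinuousSMul ℝ Y] [LocallyConvexSpace ℝ Y]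
    {B : X →ₗ[ℝ] Y →ₗ[ℝ] ℝ} (hB : IsDualPair B) {Φ : X → EReal} (hΦ : IsGammaZero Φ)
    (h : HasRelContinuityPoint tX Φ ∨ HasRelContinuityPoint (mackeyTopology B) (conj B Φ))
    {x₀ : X} (hx₀ : x₀ ∈ dom Φ) {G : Filter (X × ℝ × Y)} (hG : G ≤ valueFilter B Φ x₀)
    (hG' : valueFilter B Φ x₀ ⊓ comap Prod.fst (𝓝 x₀) ≤ G) :
    normalCone B (sublevel Φ (Φ x₀)) x₀ = upperLimit G (scaledSubdiff B Φ) := by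
  have happ : HasExactApproximations B Φ x₀ :=
    h.elim (fun h => h.hasExactApproximations hB hΦ x₀)
      (fun h => h.hasExactApproximations_of_conj hB hΦ x₀)
  exact ((normalCone_subset_upperLimit hB hΦ hx₀ happ).trans (upperLimit_mono hG' _)).antisymm
    ((upperLimit_mono hG _).trans (upperLimit_subset_normalCone hB hΦ.ne_bot hx₀))

theorem theorem4p4 {X Y : Type*}
    [AddCommGroup X] [Module ℝ X] [tX : TopologicalSpace X] [IsTopologicalAddGroup X]
    [ContinuousSMul ℝ X] [LocallyConvexSpace ℝ X]
    [AddCommGroup Y] [Module ℝ Y] [TopologicalSpace Y] [IsTopologicalAddGroup Y]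
    [ContinuousSMul ℝ Y] [LocallyConvexSpace ℝ Y]
    (B : X →ₗ[ℝ] Y →ₗ[ℝ] ℝ) (hB : IsDualPair B)
    (Φ : X → EReal) (hΦ : IsGammaZero Φ)
    (h : FiniteContinuousOnRelInterior tX Φ ∨
      FiniteContinuousOnRelInterior (mackeyTopology B) (conj B Φ))
    (x₀ : X) (hx₀ : x₀ ∈ dom Φ) :
    normalCone B (sublevel Φ (Φ x₀)) x₀ =
        upperLimit (valueFilter B Φ x₀ ⊓ quotientFilter B (dom (conj B Φ)) x₀)
          (scaledSubdiff B Φ) ∧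
      upperLimit (valueFilter B Φ x₀ ⊓ quotientFilter B (dom (conj B Φ)) x₀)
          (scaledSubdiff B Φ) =
        upperLimit (valueFilter B Φ x₀) (scaledSubdiff B Φ) := by
  have hri := h.imp FiniteContinuousOnRelInterior.hasRelContinuityPoint
    FiniteContinuousOnRelInterior.hasRelContinuityPoint
  have hquot := theorem4p4_general hB hΦ hri hx₀ inf_le_left
    (inf_le_inf_left _ (comap_fst_nhds_le_quotientFilter B (dom (conj B Φ)) x₀))
  exact ⟨hquot, hquot.symm.trans (theorem4p4_general hB hΦ hri hx₀ le_rfl inf_le_left)⟩
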